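/- **Definitions.** Write $\mathbb C_+=\{z:\operatorname{Im}z>0\}$ and $\Gamma_{\eta,M}=\{z: \operatorname{Im}z>M,\ |\operatorname{Im}z|>\eta|\operatorname{Re}z|\}$ for $\eta,M>0$. For a probability measure $\mu$ on $\mathbb R$ let $G_\mu(z)=\int_{\mathbb R}\frac{\mu(dx)}{z-x}$, $F_\mu=1/G_\mu$ and $\psi_\mu(z)=\int_{\mathbb R}\frac{zx}{1-zx}\,\mu(dx)$. Whenever $F_\mu$ is injective on $\Gamma_{\eta,M}$ and $\Gamma_{\eta',M'}\subset F_\mu(\Gamma_{\eta,M})$, the Voiculescu transform is $\phi_\mu(z)=F_\mu^{-1}(z)-z$ on $\Gamma_{\eta',M'}$; its domain $\mathcal D_\mu$ is the union of all such $\Gamma_{\eta',M'}$. Put $R_\mu(z)=z\phi_\mu(1/z)$ for $1/z\in\mathcal D_\mu$. The free convolution $\mu\boxplus\nu$ is the probability measure with $\phi_{\mu\boxplus\nu}=\phi_\mu+\phi_\nu$ on some $\Gamma_{\eta,M}$; $\mu$ is freely infinitely divisible if for every $n\ge1$ there is a probability measure $\mu_n$ with $\mu=\mu_n^{\boxplus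 n}$. The measure $\mu$ is free compound Poisson if $R_\mu=\lambda\psi_\nu$ for some $\lambda\ge0$ and some probability measure $\nu$ with $\nu(\{0\})=0$. A measure $\nu\ge 0$ with $\nu(\{0\})=0$ and $\int\min\{1,x^2\}\,\nu(dx)<\infty$ is the Lévy measure of $\mu$ if, for some $c\in\mathbb R$ and $a\ge0$, $R_\mu(z)=cz+az^2+\int_{\mathbb R}\bigl(\frac1{1-xz}-1-xz\mathbf 1_{\{|x|\le1\}}(x)\bigr)\nu(dx)$. A pair $(\alpha,s)$ with $s\in\mathbb C\setminus\{0\}$ is admissible if either $0<\alpha\le1$ and $(1-\alpha)\pi\le\arg s\le\pi$, or $1<\alpha\le2$ and $0\le\arg s\le(2-\alpha)\pi$. For $r\geq 1$, $\mu^\alpha_{s,r}$ denotes the probability measure with $$G_{\mu^\alpha_{s,r}}(z)=-r^{1/\alpha}\Bigl(\frac{1-(1-s(-\frac1z)^\alpha)^{1/r}}{s}\Bigr)^{1/\alpha},\qquad z\in\mathbb C_+,$$ and the monotone $\alpha$-stable law $a^\alpha_s$ is the probability measure with $$F_{a^\alpha_s}(z)=\bigl(z^\alpha+(-1)^{\alpha-1}s\bigr)^{1/\alpha},\qquad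 z\in\mathbb C_+.$$ Here powers with exponents $\alpha$, $\alpha-1$, $1/\alpha$ of complex numbers are taken on $\mathbb C\setminus[0,\infty)$ with argument in $(0,2\pi)$, and the power $1/r$ is the principal one on $\mathbb C\setminus(-\infty,0]$. **Theorem.** Let $(\alpha,s)$ be admissible. Then the probability measures $\mu=\mu^\alpha_{s,2}$ and $a=a^\alpha_{s/4}$ exist, and for every $\eta>0$ there is $M>0$ with $\Gamma_{\eta,M}\subset\mathcal D_\mu$. The measure $\mu$ is free compound Poisson, with $\lambda=1$ and $\nu=a$ (in particular $a(\{0\})=0$), and the Lévy measure of $\mu$ is $a$. Explicitly, $R_\mu(z)=\psi_a(z)$ for all $z$ with $1/z\in\mathcal D_\mu$, equivalently $\phi_\mu(z)=z^2G_a(z)-z$ for all $z\in\mathcal D_\mu$. In particular $\mu$ is freely infinitely divisible. -/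

import Mathlib

open MeasureTheory

noncomputable section

namespace FreeProb

/-! ### Cauchy transforms and Voiculescu transforms -/

/-- The Cauchy transform `G_μ(z) = ∫ μ(dx) / (z - x)`. -/
def cauchyTransform (μ : Measure ℝ) (z : ℂ) : ℂ := ∫ x : ℝ, (z - (x : ℂ))⁻¹ ∂μ

/-- The reciprocal Cauchy transform `F_μ = 1 / G_μ`. -/
def recipCauchy (μ : Measure ℝ) (z : ℂ) : ℂ := (cauchyTransform μ z)⁻¹

/-- The truncated cone `Γ_{η,M} = {z : Im z > M, |Im z| > η |Re z|}`. -/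
def truncCone (η M : ℝ) : Set ℂ := {z | M < z.im ∧ η * |z.re| < |z.im|}

/-- `F_μ` is univalent in `Γ_{η,M}` and `Γ_{η',M'} ⊆ F_μ(Γ_{η,M})`, all parameters being positive:
the data needed to invert `F_μ` on `Γ_{η',M'}`. -/
structure InvertsOn (μ : Measure ℝ) (η M η' M' : ℝ) : Prop where
  eta_pos : 0 < η
  M_pos : 0 < M
  eta'_pos : 0 < η'
  M'_pos : 0 < M'
  univalent : Set.InjOn (recipCauchy μ) (truncCone η M)
  subset_image : truncCone η' M' ⊆ recipCauchy μ '' truncCone η M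

/-- The domain of the Voiculescu transform: the union of all the cones `Γ_{η',M'}` on which
`F_μ` can be inverted. -/
def voiculescuDomain (μ : Measure ℝ) : Set ℂ :=
  {z | ∃ η M η' M' : ℝ, InvertsOn μ η M η' M' ∧ z ∈ truncCone η' M'}

/-- `w` is the value at `z` of an inverse `Γ_{η',M'} → Γ_{η,M}` of `F_μ`. -/
def IsInverseValue (μ : Measure ℝ) (z w : ℂ) : Prop :=
  ∃ η M η' M' : ℝ, InvertsOn μ η M η' M' ∧ z ∈ truncCone η' M' ∧ w ∈ truncCone η M ∧
    recipCauchy μ w = z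

open Classical in
/-- The Voiculescu transform `φ_μ(z) = F_μ⁻¹(z) - z` on `voiculescuDomain μ` (and `0` elsewhere).
By the identity theorem the inverse value does not depend on the cones used to compute it. -/
def voiculescu (μ : Measure ℝ) (z : ℂ) : ℂ :=
  if h : ∃ w, IsInverseValue μ z w then h.choose - z else 0

/-- The `R`-transform `R_μ(z) = z φ_μ(1/z)`, meaningful when `1/z ∈ voiculescuDomain μ`. -/
def rTransform (μ : Measure ℝ) (z : ℂ) : ℂ := z * voiculescu μ z⁻¹

/-- `ψ_μ(z) = ∫ zx / (1 - zx) μ(dx)`. -/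
def psiTransform (μ : Measure ℝ) (z : ℂ) : ℂ := ∫ x : ℝ, (z * (x : ℂ)) / (1 - z * (x : ℂ)) ∂μ

/-! ### Free convolution and free infinite divisibility -/

/-- `ρ = μ ⊞ ν`: all three are probability measures on `ℝ`, and `φ_ρ = φ_μ + φ_ν` on some
truncated cone on which all three transforms are defined. -/
structure IsFreeConv (μ ν ρ : Measure ℝ) : Prop where
  prob_left : IsProbabilityMeasure μ
  prob_right : IsProbabilityMeasure ν
  prob : IsProbabilityMeasure ρ
  voiculescu_add : ∃ η M : ℝ, 0 < η ∧ 0 < M ∧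
    truncCone η M ⊆ voiculescuDomain μ ∩ voiculescuDomain ν ∩ voiculescuDomain ρ ∧
    ∀ z ∈ truncCone η M, voiculescu ρ z = voiculescu μ z + voiculescu ν z

/-- `IsFreeConvPow ν n ρ` says that `ρ = ν ⊞ ⋯ ⊞ ν` (`n` factors); the empty convolution is the
point mass at `0`. -/
def IsFreeConvPow (ν : Measure ℝ) : ℕ → Measure ℝ → Prop
  | 0, ρ => ρ = Measure.dirac 0
  | n + 1, ρ => ∃ σ : Measure ℝ, IsFreeConvPow ν n σ ∧ IsFreeConv σ ν ρ

/-- `μ` is a probability measure that is infinitely divisible for `⊞`. -/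
def IsFreelyInfDiv (μ : Measure ℝ) : Prop :=
  IsProbabilityMeasure μ ∧
    ∀ n : ℕ, 1 ≤ n → ∃ ν : Measure ℝ, IsProbabilityMeasure ν ∧ IsFreeConvPow ν n μ

/-- `ν` is the Lévy measure of `μ`: it is the measure in the free Lévy–Khintchine representation
`R_μ(z) = c z + a z² + ∫ (1/(1 - xz) - 1 - xz 1_{|x| ≤ 1}(x)) ν(dx)`. -/
def IsFreeLevyMeasure (μ ν : Measure ℝ) : Prop :=
  ν {0} = 0 ∧ (∫⁻ x : ℝ, ENNReal.ofReal (min 1 (x ^ 2)) ∂ν) < ⊤ ∧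
    ∃ c a : ℝ, 0 ≤ a ∧ ∀ z : ℂ, z⁻¹ ∈ voiculescuDomain μ →
      rTransform μ z = c * z + a * z ^ 2 +
        ∫ x : ℝ, (1 / (1 - (x : ℂ) * z) - 1 -
          (x : ℂ) * z * (Set.indicator {y : ℝ | |y| ≤ 1} (fun _ => (1 : ℂ)) x)) ∂ν

/-- `μ` is the free compound Poisson law with rate `lam` and jump distribution `ν`:
`R_μ = lam ψ_ν`, where `ν` is a probability measure without an atom at `0` and `lam ≥ 0`. -/
structure IsFreeCompoundPoissonWith (μ : Measure ℝ) (lam : ℝ) (ν : Measure ℝ) : Prop where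
  prob : IsProbabilityMeasure μ
  rate_nonneg : 0 ≤ lam
  prob_jump : IsProbabilityMeasure ν
  jump_zero : ν {0} = 0
  rTransform_eq : ∀ z : ℂ, z⁻¹ ∈ voiculescuDomain μ → rTransform μ z = lam * psiTransform ν z

/-- `μ` is a free compound Poisson law. -/
def IsFreeCompoundPoisson (μ : Measure ℝ) : Prop :=
  ∃ (lam : ℝ) (ν : Measure ℝ), IsFreeCompoundPoissonWith μ lam ν

/-! ### The measures -/

/-- The logarithm on `ℂ \ [0, ∞)` with imaginary part in `(0, 2π)`. -/
def logOne (z : ℂ) : ℂ := Complex.log (-z) + Real.pi * Complex.I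

/-- The power `z ^ c` on `ℂ \ [0, ∞)` taken with the logarithm `logOne`. -/
def powOne (z : ℂ) (c : ℝ) : ℂ := Complex.exp (c * logOne z)

/-- Admissible pairs `(α, s)`; `Complex.arg` takes its values in `(-π, π]`. -/
def Admissible (α : ℝ) (s : ℂ) : Prop :=
  s ≠ 0 ∧
    ((0 < α ∧ α ≤ 1 ∧ (1 - α) * Real.pi ≤ s.arg ∧ s.arg ≤ Real.pi) ∨
      (1 < α ∧ α ≤ 2 ∧ 0 ≤ s.arg ∧ s.arg ≤ (2 - α) * Real.pi))

/-- `G^α_{s,r}(z) = -r^{1/α} ((1 - (1 - s(-1/z)^α)^{1/r}) / s)^{1/α}`. The powers `α` and `1/α` are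
taken with `logOne`; the power `1/r` is the principal one. -/
def muCauchy (α : ℝ) (s : ℂ) (r : ℝ) (z : ℂ) : ℂ :=
  -((r ^ (1 / α) : ℝ) : ℂ) *
    powOne ((1 - (1 - s * powOne (-1 / z) α) ^ ((1 / r : ℝ) : ℂ)) / s) (1 / α)

/-- `μ` is a probability measure with Cauchy transform `G^α_{s,r}` on the upper half-plane. -/
def IsMuLaw (α : ℝ) (s : ℂ) (r : ℝ) (μ : Measure ℝ) : Prop :=
  IsProbabilityMeasure μ ∧ ∀ z : ℂ, 0 < z.im → cauchyTransform μ z = muCauchy α s r z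

open Classical in
/-- The measure `μ^α_{s,r}`: the probability measure with Cauchy transform `G^α_{s,r}`
(and `0` if there is none). -/
def muLaw (α : ℝ) (s : ℂ) (r : ℝ) : Measure ℝ :=
  if h : ∃ μ, IsMuLaw α s r μ then h.choose else 0

/-- `a` is a probability measure with reciprocal Cauchy transform
`F_a(z) = (z^α + (-1)^{α-1} s)^{1/α}` on the upper half-plane. -/
def IsMonotoneStable (α : ℝ) (s : ℂ) (a : Measure ℝ) : Prop :=
  IsProbabilityMeasure a ∧ ∀ z : ℂ, 0 < z.im →
    recipCauchy a z = powOne (powOne z α + powOne (-1) (α - 1) * s) (1 / α)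

open Classical in
/-- The monotone strictly `α`-stable law `a^α_s`: the probability measure with
`F(z) = (z^α + (-1)^{α-1} s)^{1/α}` (and `0` if there is none). -/
def monotoneStable (α : ℝ) (s : ℂ) : Measure ℝ :=
  if h : ∃ a, IsMonotoneStable α s a then h.choose else 0

end FreeProb

end

/-!
The measure `μ^α_{s,2}` is identified with the free compound Poisson law of rate `1` and jump
distribution `a = a^α_{s/4}`, and that law is constructed together with all its convolution roots.

*Cauchy transforms.* By Herglotz' theorem, transported from the disc to the upper half-plane `ℂ⁺`,
a holomorphic map `G` from `ℂ⁺` to the closed lower half-plane with `iy G(iy) → 1` is the Cauchy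
transform of a probability measure (`exists_cauchyTransform_eq`). All measures below are obtained
from this criterion.

*Free compound Poisson laws.* For a probability measure `a` and a rate `lam ≥ 0` let
`H(z) = z + lam ∫ z x / (z - x) a(dx)`. With `V(z) = ∫ x² / |z - x|² a(dx)` one has
`Im H(z) = Im z (1 - lam V(z))`, while `(H(z) - H(z')) / (z - z')` differs from `1` by at most
`lam (V(z) + V(z')) / 2`. So `lam V < 1` where `H` takes values in `ℂ⁺`, and there `H` is injective
with nonvanishing derivative. The same bound `lam V < 1` gives uniform integrability of
`x / (z - x)`, whence `H(z) / z → 1` without restriction to a cone and `H` is proper; therefore `H`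
maps onto `ℂ⁺` (`exists_freePoissonInverse_eq`). Its right inverse `F` is the reciprocal Cauchy
transform of a probability measure whose Voiculescu transform is `H(z) - z`, on a domain that
contains the far part of every cone. The rates add up under `⊞`, so dividing the rate by `n` gives
the `n`-th convolution root.

*The two explicit laws.* Admissibility of `(α, s)` puts `z ^ α + (-1) ^ (α - 1) s` in the sector
`0 < arg < απ` (`im_logOne_exp_sub_lt`), so that its power `1 / α` maps `ℂ⁺` to itself and `a`
exists. It has no atom at `0`, since `F_a(iy)` stays away from `0` as `y → 0`. For rate `1` one has
`H(z) = z² / F_a(z)`; with `u = (-1/z) ^ α` the equation `H(z) = w` reads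
`(-1/w) ^ α = u - s u² / 4`, that is `1 - s (-1/w) ^ α = (1 - s u / 2)²`. Solving for `z` gives the
defining formula of `μ^α_{s,2}`, once a connectedness argument shows that `1 - s u / 2` is the
principal square root (`Admissible.isMuLaw`).
-/

namespace FreeProb

open MeasureTheory Filter Topology Set Metric

/-! ### The Herglotz representation on the unit disc -/

/-- The Poisson formula for the dilate `z ↦ Re f(r z)`, `r < 1`, read as an integral against the
measure on `[0, 2π]` whose density is `Re f(r e^{iθ}) / 2π`; its mass `Re f(0)` does not depend on
`r`. -/
theorem exists_finiteMeasure_poisson_dilate {f : ℂ → ℂ} (hf : DifferentiableOn ℂ f (ball 0 1))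
    (hpos : ∀ w ∈ ball (0 : ℂ) 1, 0 ≤ (f w).re) {r : ℝ} (hr0 : 0 < r) (hr1 : r < 1) :
    ∃ m : FiniteMeasure ℝ, m.mass ≤ (f 0).re.toNNReal ∧ m (Icc 0 (2 * Real.pi))ᶜ = 0 ∧
      ∀ w ∈ ball (0 : ℂ) 1,
        ∫ θ, poissonKernel 0 w (circleMap 0 1 θ) ∂(m : Measure ℝ) = (f (r * w)).re := by
  set u : ℂ → ℝ := fun z => (f (r * z)).re with hu
  have hmem : ∀ z ∈ closedBall (0 : ℂ) 1, (r : ℂ) * z ∈ ball (0 : ℂ) 1 := by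
    intro z hz
    simp only [mem_closedBall, dist_zero_right, mem_ball, norm_mul, Complex.norm_real,
      Real.norm_eq_abs, abs_of_pos hr0] at hz ⊢
    nlinarith
  have hharm : InnerProductSpace.HarmonicOnNhd u (closedBall 0 1) := by
    intro z hz
    have h1 : AnalyticAt ℂ f (r * z) :=
      hf.analyticAt (isOpen_ball.mem_nhds (hmem z hz))
    have h2 : AnalyticAt ℂ (fun z => f (r * z)) z :=
      AnalyticAt.fun_comp h1 (analyticAt_const.mul analyticAt_id)
    exact h2.harmonicAt_re
  have hucont : Continuous fun θ : ℝ => u (circleMap 0 1 θ) := by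
    rw [continuous_iff_continuousAt]
    intro θ
    have h1 : ContinuousAt f (r * circleMap 0 1 θ) :=
      (hf.differentiableAt (isOpen_ball.mem_nhds (hmem _
        (circleMap_mem_closedBall 0 zero_le_one θ)))).continuousAt
    have h2 : ContinuousAt (fun θ : ℝ => (r : ℂ) * circleMap 0 1 θ) θ := by fun_prop
    exact Complex.continuous_re.continuousAt.comp
      (ContinuousAt.comp (f := fun θ : ℝ => (r : ℂ) * circleMap 0 1 θ) h1 h2)
  have hu0 : ∀ θ : ℝ, 0 ≤ (2 * Real.pi)⁻¹ * u (circleMap 0 1 θ) := fun θ =>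
    mul_nonneg (by positivity)
      (hpos _ (hmem _ (circleMap_mem_closedBall 0 zero_le_one θ)))
  set d : ℝ → NNReal := fun θ => ((2 * Real.pi)⁻¹ * u (circleMap 0 1 θ)).toNNReal with hd
  have hdm : Measurable d := (hucont.measurable.const_mul _).real_toNNReal
  set μ : Measure ℝ := (volume.restrict (Ioc 0 (2 * Real.pi))).withDensity (fun θ => (d θ : ENNReal))
    with hμ
  have hint : ∀ w ∈ ball (0 : ℂ) 1,
      ∫ θ, poissonKernel 0 w (circleMap 0 1 θ) ∂μ = (f (r * w)).re := by
    intro w hw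
    rw [hμ, integral_withDensity_eq_integral_smul hdm,
      ← intervalIntegral.integral_of_le (by positivity)]
    have := hharm.circleAverage_poissonKernel_smul hw
    rw [Real.circleAverage_def, ← intervalIntegral.integral_smul] at this
    rw [show (f (r * w)).re = u w from rfl, ← this]
    refine intervalIntegral.integral_congr fun θ _ => ?_
    simp only [hd, NNReal.smul_def, Real.coe_toNNReal _ (hu0 θ), smul_eq_mul,
      Pi.smul_apply']
    ring
  have hmass : μ univ = ENNReal.ofReal (f 0).re := by
    have h0 := hint 0 (by simp)
    have hk : ∀ θ : ℝ, poissonKernel 0 0 (circleMap 0 1 θ) = 1 := by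
      intro θ; simp [poissonKernel_def]
    simp only [hk, mul_zero] at h0
    have hfin : μ univ ≠ ⊤ := by
      rw [hμ, withDensity_apply _ MeasurableSet.univ, Measure.restrict_univ]
      have : IntegrableOn (fun θ => (2 * Real.pi)⁻¹ * u (circleMap 0 1 θ))
          (Ioc 0 (2 * Real.pi)) volume :=
        (continuous_const.mul hucont).integrableOn_Ioc
      have h2 := this.lintegral_lt_top
      exact h2.ne
    rw [integral_const, smul_eq_mul, mul_one] at h0
    rw [← h0, measureReal_def, ENNReal.ofReal_toReal hfin]
  have hfinite : IsFiniteMeasure μ := ⟨by rw [hmass]; exact ENNReal.ofReal_lt_top⟩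
  let m : FiniteMeasure ℝ := ⟨μ, hfinite⟩
  refine ⟨m, ?_, ?_, hint⟩
  · rw [← ENNReal.coe_le_coe, FiniteMeasure.ennreal_mass]
    exact hmass.le
  · rw [FiniteMeasure.null_iff_toMeasure_null]
    change μ _ = 0
    refine withDensity_absolutelyContinuous _ _ ?_
    rw [Measure.restrict_apply measurableSet_Icc.compl]
    convert measure_empty (μ := volume)
    ext x
    simp only [mem_inter_iff, mem_compl_iff, mem_Icc, mem_Ioc, mem_empty_iff_false, iff_false]
    rintro ⟨h1, h2, h3⟩
    exact h1 ⟨h2.le, h3⟩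

/-- **Herglotz representation**: a holomorphic function on the unit disc with nonnegative real
part has its real part equal to the Poisson integral of a finite measure, here carried by the
angular variable. -/
theorem exists_poisson_representation {f : ℂ → ℂ} (hf : DifferentiableOn ℂ f (ball 0 1))
    (hpos : ∀ w ∈ ball (0 : ℂ) 1, 0 ≤ (f w).re) :
    ∃ m : Measure ℝ, IsFiniteMeasure m ∧
      ∀ w ∈ ball (0 : ℂ) 1,
        ∫ θ, poissonKernel 0 w (circleMap 0 1 θ) ∂m = (f w).re := by
  set ρ : ℕ → ℝ := fun n => 1 - 1 / ((n : ℝ) + 2) with hρ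
  have hρ1 : ∀ n, ρ n < 1 := fun n => by
    have : 0 < 1 / ((n : ℝ) + 2) := by positivity
    simp only [hρ]; linarith
  have hρ0 : ∀ n, 0 < ρ n := fun n => by
    have : 1 / ((n : ℝ) + 2) < 1 := by
      rw [div_lt_one (by positivity)]; linarith [n.cast_nonneg (α := ℝ)]
    simp only [hρ]; linarith
  have hρlim : Tendsto ρ atTop (𝓝 1) := by
    have h1 : Tendsto (fun n : ℕ => (n : ℝ) + 2) atTop atTop :=
      tendsto_atTop_add_const_right _ _ tendsto_natCast_atTop_atTop
    have h2 := (h1.const_div_atTop 1).const_sub (1 : ℝ)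
    simpa [hρ] using h2
  choose m hm1 hm2 hm3 using fun n => exists_finiteMeasure_poisson_dilate hf hpos (hρ0 n) (hρ1 n)
  have hcpt := isCompact_setOfPred_finiteMeasure_le_of_isCompact (E := ℝ) (f 0).re.toNNReal
    (isCompact_Icc (a := 0) (b := 2 * Real.pi))
  set l : Ultrafilter ℕ := Ultrafilter.of atTop with hl
  have hle : (l : Filter ℕ) ≤ atTop := Ultrafilter.of_le _
  obtain ⟨M, -, hM⟩ := isCompact_iff_ultrafilter_le_nhds'.1 hcpt (l.map m)
    (Ultrafilter.mem_map.2 (Filter.mem_of_superset univ_mem fun n _ => ⟨hm1 n, hm2 n⟩))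
  have hM' : Tendsto m l (𝓝 M) := hM
  rw [FiniteMeasure.tendsto_iff_forall_integral_tendsto] at hM'
  refine ⟨M, inferInstance, fun w hw => ?_⟩
  have hw1 : ‖w‖ < 1 := by simpa using hw
  have hne : ∀ θ : ℝ, 1 - ‖w‖ ≤ ‖circleMap 0 1 θ - w‖ := fun θ => by
    have := norm_sub_norm_le (circleMap 0 1 θ) w
    simpa using this
  have hcont : Continuous fun θ : ℝ => poissonKernel 0 w (circleMap 0 1 θ) := by
    simp only [poissonKernel_def, sub_zero]
    refine Continuous.div (by fun_prop) (by fun_prop) fun θ => ?_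
    have := hne θ
    have h3 : 0 < ‖circleMap 0 1 θ - w‖ := by linarith
    positivity
  have hbd : ∀ θ : ℝ, ‖poissonKernel 0 w (circleMap 0 1 θ)‖ ≤ (1 - ‖w‖ ^ 2) / (1 - ‖w‖) ^ 2 := by
    intro θ
    have h2 : 0 ≤ 1 - ‖w‖ ^ 2 := by nlinarith [norm_nonneg w]
    have h4 : 0 < 1 - ‖w‖ := by linarith
    simp only [poissonKernel_def, sub_zero, norm_circleMap_zero, abs_one, one_pow]
    rw [Real.norm_eq_abs, abs_of_nonneg (by positivity)]
    have := hne θ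
    gcongr
  have h1 := hM' (BoundedContinuousFunction.ofNormedAddCommGroup _ hcont _ hbd)
  simp only [BoundedContinuousFunction.coe_ofNormedAddCommGroup, hm3 _ w hw] at h1
  have h2 : Tendsto (fun n => (f (ρ n * w)).re) atTop (𝓝 (f w).re) := by
    have hc : ContinuousAt f w := (hf.differentiableAt (isOpen_ball.mem_nhds hw)).continuousAt
    have h3 : Tendsto (fun n => (ρ n : ℂ) * w) atTop (𝓝 w) := by
      have := ((Complex.continuous_ofReal.tendsto 1).comp hρlim).mul_const w
      simpa using this
    exact (Complex.continuous_re.tendsto _).comp (hc.tendsto.comp h3)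
  exact tendsto_nhds_unique h1 (h2.mono_left hle)

/-! ### Cauchy transforms on the upper half-plane -/

lemma ofReal_sub_im (z : ℂ) (x : ℝ) : (z - x).im = z.im := by simp

lemma sub_ofReal_ne_zero {z : ℂ} (hz : 0 < z.im) (x : ℝ) : z - x ≠ 0 := fun h => by
  have := congrArg Complex.im h
  simp at this
  exact hz.ne' this

lemma im_le_norm_sub_ofReal {z : ℂ} (hz : 0 < z.im) (x : ℝ) : z.im ≤ ‖z - x‖ := by
  have := Complex.abs_im_le_norm (z - x)
  rwa [ofReal_sub_im, abs_of_pos hz] at this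

lemma norm_inv_sub_ofReal_le {z : ℂ} (hz : 0 < z.im) (x : ℝ) : ‖(z - x)⁻¹‖ ≤ z.im⁻¹ := by
  rw [norm_inv]
  exact inv_anti₀ hz (im_le_norm_sub_ofReal hz x)

lemma integrable_inv_sub_ofReal (μ : Measure ℝ) [IsFiniteMeasure μ] {z : ℂ} (hz : 0 < z.im) :
    Integrable (fun x : ℝ => (z - (x : ℂ))⁻¹) μ := by
  refine Integrable.of_bound (C := z.im⁻¹) ?_ (ae_of_all _ (norm_inv_sub_ofReal_le hz))
  exact (Continuous.inv₀ (by fun_prop) (sub_ofReal_ne_zero hz)).aestronglyMeasurable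

lemma norm_cauchyTransform_le (μ : Measure ℝ) [IsProbabilityMeasure μ] {z : ℂ} (hz : 0 < z.im) :
    ‖cauchyTransform μ z‖ ≤ z.im⁻¹ := by
  have := norm_integral_le_of_norm_le_const (μ := μ) (ae_of_all _ (norm_inv_sub_ofReal_le hz))
  simpa [cauchyTransform] using this

lemma im_cauchyTransform (μ : Measure ℝ) [IsFiniteMeasure μ] {z : ℂ} (hz : 0 < z.im) :
    (cauchyTransform μ z).im = -∫ x : ℝ, z.im / ‖z - x‖ ^ 2 ∂μ := by
  have h := Complex.imCLM.integral_comp_comm (integrable_inv_sub_ofReal μ hz)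
  simp only [Complex.imCLM_apply] at h
  rw [cauchyTransform, ← h, ← integral_neg]
  refine integral_congr_ae (ae_of_all _ fun x => ?_)
  simp [Complex.inv_im, Complex.normSq_eq_norm_sq, neg_div]

lemma differentiableOn_cauchyTransform (μ : Measure ℝ) [IsFiniteMeasure μ] :
    DifferentiableOn ℂ (cauchyTransform μ) {z | 0 < z.im} := by
  have key : cauchyTransform μ = fun z => -resolventTransform μ z := by
    ext z
    rw [cauchyTransform, resolventTransform_apply, ← integral_neg]
    refine integral_congr_ae (ae_of_all _ fun x => ?_)
    simp only [resolvent, Ring.inverse_eq_inv', Complex.coe_algebraMap]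
    rw [← neg_sub, inv_neg]
  rw [key]
  intro z hz
  refine DifferentiableAt.differentiableWithinAt (DifferentiableAt.neg ?_)
  refine (hasDerivAt_resolventTransform (μ := μ) z ?_).differentiableAt
  rintro ⟨x, -, rfl⟩
  simp at hz

lemma isOpen_upperHalfPlane : IsOpen {z : ℂ | 0 < z.im} :=
  isOpen_lt continuous_const Complex.continuous_im

lemma isPreconnected_upperHalfPlane : IsPreconnected {z : ℂ | 0 < z.im} :=
  (convex_halfSpace_im_gt 0).isPreconnected

/-- The Poisson kernel of the disc, transported to the upper half-plane by the Cayley transform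
`z ↦ (z - i) / (z + i)`. -/
lemma poissonKernel_cayley {z : ℂ} (hz : 0 < z.im) (θ : ℝ) :
    poissonKernel 0 ((z - Complex.I) / (z + Complex.I)) (circleMap 0 1 θ) =
      z.im / ‖z * Real.sin (θ / 2) + Real.cos (θ / 2)‖ ^ 2 := by
  have hz1 : z + Complex.I ≠ 0 := fun h => by
    have := congrArg Complex.im h
    simp at this; linarith
  have hn : 0 < ‖z + Complex.I‖ := norm_pos_iff.2 hz1
  set e : ℂ := Complex.exp ((θ / 2 : ℝ) * Complex.I) with he
  have hen : ‖e‖ = 1 := Complex.norm_exp_ofReal_mul_I _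
  have hcirc : circleMap 0 1 θ = e * e := by
    rw [he, ← Complex.exp_add, circleMap_zero]
    push_cast
    rw [one_mul]
    congr 1
    ring
  have hecs : e = Real.cos (θ / 2) + Real.sin (θ / 2) * Complex.I := by
    rw [he, Complex.exp_mul_I]
    push_cast; ring
  have hcs : ((Real.cos (θ / 2) : ℝ) : ℂ) ^ 2 + ((Real.sin (θ / 2) : ℝ) : ℂ) ^ 2 = 1 := by
    rw [← Complex.ofReal_pow, ← Complex.ofReal_pow, ← Complex.ofReal_add,
      Real.cos_sq_add_sin_sq, Complex.ofReal_one]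
  have h1 : e * e * (z + Complex.I) - (z - Complex.I) =
      2 * Complex.I * e * (z * Real.sin (θ / 2) + Real.cos (θ / 2)) := by
    rw [hecs]
    linear_combination (z - Complex.I) * hcs +
      (Real.sin (θ / 2) ^ 2 * (z + Complex.I) - 2 * z * Real.sin (θ / 2) ^ 2) * Complex.I_sq
  have h2 : e * e - (z - Complex.I) / (z + Complex.I) =
      2 * Complex.I * e * (z * Real.sin (θ / 2) + Real.cos (θ / 2)) / (z + Complex.I) := by
    rw [← h1]; field_simp
  have h3 : ‖z + Complex.I‖ ^ 2 - ‖z - Complex.I‖ ^ 2 = 4 * z.im := by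
    rw [← Complex.normSq_eq_norm_sq, ← Complex.normSq_eq_norm_sq]
    simp [Complex.normSq_apply]
    ring
  have h4 : ‖(z * Real.sin (θ / 2) + Real.cos (θ / 2) : ℂ)‖ ≠ 0 := by
    rw [norm_ne_zero_iff]
    intro h
    have hi := congrArg Complex.im h
    have hr := congrArg Complex.re h
    simp only [Complex.add_im, Complex.mul_im, Complex.ofReal_re, Complex.ofReal_im, mul_zero,
      zero_add, add_zero, Complex.zero_im, mul_eq_zero, hz.ne', false_or] at hi
    simp [-Complex.ofReal_sin, -Complex.ofReal_cos, hi] at hr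
    have := Real.cos_sq_add_sin_sq (θ / 2)
    rw [hi, hr] at this
    norm_num at this
  rw [poissonKernel_def, hcirc]
  simp only [sub_zero]
  rw [h2]
  simp only [norm_div, norm_mul, hen, Complex.norm_I, Complex.norm_ofNat, one_pow, mul_one]
  field_simp
  linear_combination h3

/-- A holomorphic function on the upper half-plane with nonpositive imaginary part has an integral
representation of its imaginary part against the Poisson kernel, written in the angular variable
`θ`, where the boundary point is `x = -cot (θ / 2)`. -/
theorem exists_halfPlane_poisson_representation {G : ℂ → ℂ}
    (hG : DifferentiableOn ℂ G {z | 0 < z.im}) (hneg : ∀ z : ℂ, 0 < z.im → (G z).im ≤ 0) :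
    ∃ m : Measure ℝ, IsFiniteMeasure m ∧ ∀ z : ℂ, 0 < z.im →
      ∫ θ : ℝ, z.im / ‖z * Real.sin (θ / 2) + Real.cos (θ / 2)‖ ^ 2 ∂m = -(G z).im := by
  have hsub : ∀ w ∈ ball (0 : ℂ) 1, 1 - w ≠ 0 := by
    intro w hw h
    rw [sub_eq_zero] at h
    simp [← h] at hw
  set C : ℂ → ℂ := fun w => Complex.I * (1 + w) / (1 - w) with hC
  have hCim : ∀ w ∈ ball (0 : ℂ) 1, 0 < (C w).im := by
    intro w hw
    have h1 := hsub w hw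
    have h2 : (C w).im = (1 - ‖w‖ ^ 2) / ‖1 - w‖ ^ 2 := by
      rw [← Complex.normSq_eq_norm_sq, ← Complex.normSq_eq_norm_sq, hC]
      simp only [Complex.div_im, Complex.mul_im, Complex.mul_re, Complex.I_re, Complex.I_im,
        Complex.add_re, Complex.add_im, Complex.sub_re, Complex.sub_im, Complex.one_re,
        Complex.one_im, Complex.normSq_apply]
      ring
    rw [h2]
    have h3 : ‖w‖ < 1 := by simpa using hw
    have h4 : 0 < ‖1 - w‖ := norm_pos_iff.2 h1
    have h5 : 0 < 1 - ‖w‖ ^ 2 := by nlinarith [norm_nonneg w]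
    positivity
  have hCd : DifferentiableOn ℂ C (ball 0 1) := by
    intro w hw
    refine DifferentiableAt.differentiableWithinAt ?_
    exact DifferentiableAt.div (by fun_prop) (by fun_prop) (hsub w hw)
  obtain ⟨m, hm, h⟩ := exists_poisson_representation (f := fun w => Complex.I * G (C w))
    ((hG.comp hCd hCim).const_mul _) (fun w hw => by
      simpa using hneg _ (hCim w hw))
  refine ⟨m, hm, fun z hz => ?_⟩
  have hz1 : z + Complex.I ≠ 0 := fun h => by
    have := congrArg Complex.im h
    simp at this; linarith
  have hw : (z - Complex.I) / (z + Complex.I) ∈ ball (0 : ℂ) 1 := by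
    rw [mem_ball, dist_zero_right, norm_div, div_lt_one (norm_pos_iff.2 hz1),
      ← sq_lt_sq₀ (norm_nonneg _) (norm_nonneg _), ← Complex.normSq_eq_norm_sq,
      ← Complex.normSq_eq_norm_sq]
    simp only [Complex.normSq_apply, Complex.sub_re, Complex.sub_im, Complex.add_re,
      Complex.add_im, Complex.I_re, Complex.I_im]
    nlinarith
  have hCw : C ((z - Complex.I) / (z + Complex.I)) = z := by
    have h2 : z + Complex.I - (z - Complex.I) ≠ 0 := by
      ring_nf; simp
    simp only [hC]
    rw [one_add_div hz1, one_sub_div hz1, mul_div_assoc', div_div_div_cancel_right₀ hz1,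
      div_eq_iff h2]
    ring
  have h1 := h _ hw
  simp only [poissonKernel_cayley hz, hCw] at h1
  simpa using h1

/-- If moreover `iy G(iy) → 1`, then monotone convergence applied to `y ↦ -y Im G(iy)` shows that
`1 / sin² (θ / 2) = 1 + x²` has integral `1`; in particular the representing measure does not
charge the boundary point at infinity. -/
lemma lintegral_inv_sin_sq_eq_one {G : ℂ → ℂ} {m : Measure ℝ} [IsFiniteMeasure m]
    (hm : ∀ z : ℂ, 0 < z.im →
      ∫ θ : ℝ, z.im / ‖z * Real.sin (θ / 2) + Real.cos (θ / 2)‖ ^ 2 ∂m = -(G z).im)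
    (hlim : Tendsto (fun y : ℝ => (y * Complex.I) * G (y * Complex.I)) atTop (𝓝 1)) :
    ∫⁻ θ : ℝ, (ENNReal.ofReal (Real.sin (θ / 2) ^ 2))⁻¹ ∂m = 1 := by
  set g : ℕ → ℝ → ENNReal := fun n θ =>
    (ENNReal.ofReal (Real.sin (θ / 2) ^ 2 + Real.cos (θ / 2) ^ 2 * (((n : ℝ) + 1) ^ 2)⁻¹))⁻¹ with hg
  have hmeas : ∀ n, Measurable (g n) := fun n => by
    have : Continuous fun θ : ℝ =>
        Real.sin (θ / 2) ^ 2 + Real.cos (θ / 2) ^ 2 * (((n : ℝ) + 1) ^ 2)⁻¹ := by fun_prop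
    exact (this.measurable.ennreal_ofReal).inv
  have hmono : ∀ θ, Monotone fun n => g n θ := by
    intro θ n k hnk
    simp only [hg]
    gcongr
  have hlim1 : ∀ θ, Tendsto (fun n => g n θ) atTop
      (𝓝 (ENNReal.ofReal (Real.sin (θ / 2) ^ 2))⁻¹) := by
    intro θ
    refine (continuous_inv.tendsto _).comp ((ENNReal.continuous_ofReal.tendsto _).comp ?_)
    have h1 : Tendsto (fun n : ℕ => (((n : ℝ) + 1) ^ 2)⁻¹) atTop (𝓝 0) := by
      refine tendsto_inv_atTop_zero.comp ((tendsto_pow_atTop two_ne_zero).comp ?_)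
      exact tendsto_atTop_add_const_right _ _ tendsto_natCast_atTop_atTop
    simpa using (h1.const_mul (Real.cos (θ / 2) ^ 2)).const_add (Real.sin (θ / 2) ^ 2)
  have hL := lintegral_tendsto_of_tendsto_of_monotone (μ := m) (fun n => (hmeas n).aemeasurable)
    (ae_of_all _ hmono) (ae_of_all _ hlim1)
  refine tendsto_nhds_unique hL ?_
  have hval : ∀ n, ∫⁻ θ, g n θ ∂m = ENNReal.ofReal
      ((((n : ℝ) + 1 : ℝ) * Complex.I) * G (((n : ℝ) + 1 : ℝ) * Complex.I)).re := by
    intro n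
    set y : ℝ := (n : ℝ) + 1 with hy
    have hy1 : 1 ≤ y := by simp [hy]
    have hpt : ∀ θ : ℝ, y * ((y * Complex.I).im /
        ‖(y * Complex.I) * Real.sin (θ / 2) + Real.cos (θ / 2)‖ ^ 2) =
        (Real.sin (θ / 2) ^ 2 + Real.cos (θ / 2) ^ 2 * (y ^ 2)⁻¹)⁻¹ := by
      intro θ
      rw [← Complex.normSq_eq_norm_sq]
      simp only [Complex.normSq_apply, Complex.add_re, Complex.add_im, Complex.mul_re,
        Complex.mul_im, Complex.I_re, Complex.I_im, Complex.ofReal_re, Complex.ofReal_im]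
      have hy0 : y ≠ 0 := by linarith
      field_simp
      ring_nf
    have hpos : ∀ θ : ℝ, (y ^ 2)⁻¹ ≤
        Real.sin (θ / 2) ^ 2 + Real.cos (θ / 2) ^ 2 * (y ^ 2)⁻¹ := by
      intro θ
      have h1 : (y ^ 2)⁻¹ ≤ 1 := inv_le_one_of_one_le₀ (by nlinarith)
      nlinarith [Real.sin_sq_add_cos_sq (θ / 2), sq_nonneg (Real.sin (θ / 2))]
    have hy2 : 0 < (y ^ 2)⁻¹ := by positivity
    have hre : ((y * Complex.I) * G (y * Complex.I)).re = y * -(G (y * Complex.I)).im := by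
      simp
    rw [hre, ← hm _ (by simp; linarith), ← integral_const_mul]
    simp only [hpt]
    rw [ofReal_integral_eq_lintegral_ofReal]
    · refine lintegral_congr fun θ => ?_
      rw [ENNReal.ofReal_inv_of_pos (hy2.trans_le (hpos θ))]
    · refine Integrable.of_bound (C := y ^ 2) ?_ (ae_of_all _ fun θ => ?_)
      · refine (Continuous.inv₀ (by fun_prop) fun θ => ?_).aestronglyMeasurable
        exact (hy2.trans_le (hpos θ)).ne'
      · rw [norm_inv, Real.norm_eq_abs, abs_of_pos (hy2.trans_le (hpos θ))]
        exact inv_le_of_inv_le₀ (by positivity) (hpos θ)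
    · exact ae_of_all _ fun θ => inv_nonneg.2 (hy2.le.trans (hpos θ))
  simp only [hval]
  have h1 : Tendsto (fun n : ℕ => (n : ℝ) + 1) atTop atTop :=
    tendsto_atTop_add_const_right _ _ tendsto_natCast_atTop_atTop
  have h2 := (ENNReal.continuous_ofReal.tendsto _).comp
    ((Complex.continuous_re.tendsto _).comp (hlim.comp h1))
  simpa [Function.comp_def] using h2

/-- **Characterization of Cauchy transforms**: a holomorphic map `G` from the upper half-plane to
the closed lower half-plane with `iy G(iy) → 1` is the Cauchy transform of a probability
measure. -/
theorem exists_cauchyTransform_eq {G : ℂ → ℂ}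
    (hG : DifferentiableOn ℂ G {z | 0 < z.im}) (hneg : ∀ z : ℂ, 0 < z.im → (G z).im ≤ 0)
    (hlim : Tendsto (fun y : ℝ => (y * Complex.I) * G (y * Complex.I)) atTop (𝓝 1)) :
    ∃ μ : Measure ℝ, IsProbabilityMeasure μ ∧ ∀ z : ℂ, 0 < z.im → cauchyTransform μ z = G z := by
  obtain ⟨m, hmf, hm⟩ := exists_halfPlane_poisson_representation hG hneg
  have h1 := lintegral_inv_sin_sq_eq_one hm hlim
  set d : ℝ → ENNReal := fun θ => (ENNReal.ofReal (Real.sin (θ / 2) ^ 2))⁻¹ with hd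
  have hdm : Measurable d := by
    have : Continuous fun θ : ℝ => Real.sin (θ / 2) ^ 2 := by fun_prop
    exact (this.measurable.ennreal_ofReal).inv
  have hfin : ∀ᵐ θ ∂m, d θ < ⊤ := ae_lt_top hdm (by rw [h1]; exact ENNReal.one_ne_top)
  set p : ℝ → ℝ := fun θ => -Real.cos (θ / 2) / Real.sin (θ / 2) with hp
  have hpm : Measurable p := by
    refine Measurable.div ?_ ?_
    · exact Continuous.measurable (by fun_prop)
    · exact Continuous.measurable (by fun_prop)
  set μ : Measure ℝ := (m.withDensity d).map p with hμ
  have hprob' : IsProbabilityMeasure (m.withDensity d) :=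
    ⟨by rw [withDensity_apply _ MeasurableSet.univ, Measure.restrict_univ, h1]⟩
  have hprob : IsProbabilityMeasure μ := Measure.isProbabilityMeasure_map hpm.aemeasurable
  have him : ∀ z : ℂ, 0 < z.im → (cauchyTransform μ z).im = (G z).im := by
    intro z hz
    have hcont : Continuous fun x : ℝ => z.im / ‖z - x‖ ^ 2 :=
      Continuous.div (by fun_prop) (by fun_prop) fun x => by
        have := norm_pos_iff.2 (sub_ofReal_ne_zero hz x)
        positivity
    rw [im_cauchyTransform μ hz, hμ, integral_map hpm.aemeasurable hcont.aestronglyMeasurable,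
      integral_withDensity_eq_integral_toReal_smul hdm hfin, neg_eq_iff_eq_neg, ← hm z hz]
    refine integral_congr_ae ?_
    filter_upwards [hfin] with θ hθ
    have hs : Real.sin (θ / 2) ≠ 0 := by
      intro h0
      simp [hd, h0] at hθ
    have hs' : ((Real.sin (θ / 2) : ℝ) : ℂ) ≠ 0 := Complex.ofReal_ne_zero.2 hs
    have h2 : z * Real.sin (θ / 2) + Real.cos (θ / 2) = Real.sin (θ / 2) * (z - (p θ : ℝ)) := by
      simp only [hp, Complex.ofReal_div, Complex.ofReal_neg]
      field_simp
      ring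
    have h3 : (d θ).toReal = (Real.sin (θ / 2) ^ 2)⁻¹ := by
      simp only [hd]
      rw [ENNReal.toReal_inv, ENNReal.toReal_ofReal (sq_nonneg _)]
    rw [h2, h3, norm_mul, Complex.norm_real, mul_pow, Real.norm_eq_abs, sq_abs, smul_eq_mul]
    have := norm_pos_iff.2 (sub_ofReal_ne_zero hz (p θ))
    field_simp
  -- The difference has vanishing imaginary part, hence is constant, and it tends to `0` along `iy`.
  have hdiff : AnalyticOnNhd ℂ (fun z => cauchyTransform μ z - G z) {z | 0 < z.im} :=
    ((differentiableOn_cauchyTransform μ).sub hG).analyticOnNhd isOpen_upperHalfPlane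
  obtain ⟨c, hc⟩ := hdiff.eq_const_of_im_eq_const (c₀ := 0)
    (fun z hz => by simp [him z hz]) isOpen_upperHalfPlane
    ⟨⟨Complex.I, by simp⟩, isPreconnected_upperHalfPlane⟩
  have hiy : Tendsto (fun y : ℝ => y⁻¹) atTop (𝓝 0) := tendsto_inv_atTop_zero
  have hlim1 : Tendsto (fun y : ℝ => cauchyTransform μ (y * Complex.I)) atTop (𝓝 0) := by
    refine squeeze_zero_norm' ?_ hiy
    filter_upwards [eventually_gt_atTop 0] with y hy
    simpa using norm_cauchyTransform_le μ (z := y * Complex.I) (by simpa using hy)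
  have hlim2 : Tendsto (fun y : ℝ => G (y * Complex.I)) atTop (𝓝 0) := by
    have h2 : Tendsto (fun y : ℝ => ((y * Complex.I : ℂ))⁻¹) atTop (𝓝 0) := by
      refine squeeze_zero_norm' ?_ hiy
      filter_upwards [eventually_gt_atTop 0] with y hy
      simp [abs_of_pos hy]
    have h3 := h2.mul hlim
    rw [zero_mul] at h3
    refine h3.congr' ?_
    filter_upwards [eventually_gt_atTop 0] with y hy
    have : (y : ℂ) ≠ 0 := Complex.ofReal_ne_zero.2 hy.ne'
    field_simp
  have hc0 : c = 0 := by
    have h2 := hlim1.sub hlim2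
    rw [sub_zero] at h2
    refine tendsto_nhds_unique (Tendsto.congr' ?_ tendsto_const_nhds) h2
    filter_upwards [eventually_gt_atTop 0] with y hy
    exact (hc (y * Complex.I) (by simpa using hy)).symm
  refine ⟨μ, hprob, fun z hz => ?_⟩
  have := hc z hz
  rw [hc0] at this
  exact sub_eq_zero.1 this

/-! ### The inverse transform of a free compound Poisson law -/

/-- The inverse `F_μ⁻¹(z) = z + φ_μ(z)` of the reciprocal Cauchy transform of the free compound
Poisson law with rate `lam` and jump distribution `a`, as a function on the upper half-plane:
`z + lam ∫ z x / (z - x) a(dx) = z (1 + lam (z G_a(z) - 1))`. -/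
noncomputable def freePoissonInverse (lam : ℝ) (a : Measure ℝ) (z : ℂ) : ℂ :=
  z * (1 + lam * (z * cauchyTransform a z - 1))

lemma differentiableOn_freePoissonInverse (lam : ℝ) (a : Measure ℝ) [IsFiniteMeasure a] :
    DifferentiableOn ℂ (freePoissonInverse lam a) {z | 0 < z.im} := by
  have h := differentiableOn_cauchyTransform a
  unfold freePoissonInverse
  exact differentiableOn_id.mul (((differentiableOn_id.mul h).sub_const 1).const_mul _ |>.const_add 1)

lemma norm_mul_inv_sub_le {z : ℂ} (hz : 0 < z.im) (x : ℝ) :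
    ‖(x : ℂ) * (z - x)⁻¹‖ ≤ 1 + ‖z‖ / z.im := by
  have h1 : (x : ℂ) * (z - x)⁻¹ = z * (z - x)⁻¹ - 1 := by
    have := sub_ofReal_ne_zero hz x
    field_simp
    ring
  rw [h1]
  have h2 : ‖z * (z - x)⁻¹‖ ≤ ‖z‖ / z.im := by
    rw [norm_mul, div_eq_mul_inv]
    exact mul_le_mul_of_nonneg_left (norm_inv_sub_ofReal_le hz x) (norm_nonneg _)
  calc ‖z * (z - x)⁻¹ - 1‖ ≤ ‖z * (z - x)⁻¹‖ + ‖(1 : ℂ)‖ := norm_sub_le _ _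
    _ ≤ 1 + ‖z‖ / z.im := by rw [norm_one]; linarith

lemma continuous_mul_inv_sub {z : ℂ} (hz : 0 < z.im) :
    Continuous fun x : ℝ => (x : ℂ) * (z - x)⁻¹ :=
  Continuous.mul (by fun_prop) (Continuous.inv₀ (by fun_prop) (sub_ofReal_ne_zero hz))

lemma integrable_mul_inv_sub (a : Measure ℝ) [IsFiniteMeasure a] {z : ℂ} (hz : 0 < z.im) :
    Integrable (fun x : ℝ => (x : ℂ) * (z - x)⁻¹) a :=
  Integrable.of_bound (continuous_mul_inv_sub hz).aestronglyMeasurable _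
    (ae_of_all _ (norm_mul_inv_sub_le hz))

lemma mul_cauchyTransform_sub_one (a : Measure ℝ) [IsProbabilityMeasure a] {z : ℂ}
    (hz : 0 < z.im) :
    z * cauchyTransform a z - 1 = ∫ x : ℝ, (x : ℂ) * (z - x)⁻¹ ∂a := by
  have h1 : ∀ x : ℝ, (x : ℂ) * (z - x)⁻¹ = z * (z - x)⁻¹ - 1 := fun x => by
    have := sub_ofReal_ne_zero hz x
    field_simp
    ring
  simp only [h1]
  rw [integral_sub ((integrable_inv_sub_ofReal a hz).const_mul _) (integrable_const _),
    integral_const_mul]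
  simp [cauchyTransform]

/-- The quadratic mean `∫ x² / |z - x|² a(dx)`, the ratio `-Im φ / Im z` for
`φ(z) = ∫ z x / (z - x) a(dx)`. -/
noncomputable def quadMean (a : Measure ℝ) (z : ℂ) : ℝ := ∫ x : ℝ, ‖(x : ℂ) * (z - x)⁻¹‖ ^ 2 ∂a

lemma integrable_norm_mul_inv_sub_sq (a : Measure ℝ) [IsFiniteMeasure a] {z : ℂ}
    (hz : 0 < z.im) : Integrable (fun x : ℝ => ‖(x : ℂ) * (z - x)⁻¹‖ ^ 2) a := by
  refine Integrable.of_bound (C := (1 + ‖z‖ / z.im) ^ 2)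
    ((continuous_mul_inv_sub hz).norm.pow 2).aestronglyMeasurable (ae_of_all _ fun x => ?_)
  rw [Real.norm_eq_abs, abs_of_nonneg (by positivity)]
  exact pow_le_pow_left₀ (norm_nonneg _) (norm_mul_inv_sub_le hz x) 2

lemma im_freePoissonInverse (lam : ℝ) (a : Measure ℝ) [IsProbabilityMeasure a] {z : ℂ}
    (hz : 0 < z.im) :
    (freePoissonInverse lam a z).im = z.im * (1 - lam * quadMean a z) := by
  have h1 : (z * (z * cauchyTransform a z - 1)).im = -(z.im * quadMean a z) := by
    rw [mul_cauchyTransform_sub_one a hz, ← integral_const_mul, quadMean, ← integral_const_mul,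
      ← integral_neg]
    have h := Complex.imCLM.integral_comp_comm ((integrable_mul_inv_sub a hz).const_mul z)
    simp only [Complex.imCLM_apply] at h
    rw [← h]
    refine integral_congr_ae (ae_of_all _ fun x => ?_)
    have h2 := sub_ofReal_ne_zero hz x
    have h3 : Complex.normSq (z - x) ≠ 0 := by simpa [Complex.normSq_eq_zero] using h2
    simp only [norm_mul, norm_inv, Complex.norm_real, mul_pow, Real.norm_eq_abs, sq_abs, inv_pow,
      ← Complex.normSq_eq_norm_sq]
    simp only [Complex.mul_im, Complex.mul_re, Complex.inv_im, Complex.inv_re, Complex.ofReal_re,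
      Complex.ofReal_im, Complex.sub_re, Complex.sub_im]
    field_simp
    ring
  have h2 : freePoissonInverse lam a z = z + lam * (z * (z * cauchyTransform a z - 1)) := by
    unfold freePoissonInverse; ring
  rw [h2, Complex.add_im, Complex.im_ofReal_mul, h1]
  ring

/-- The divided differences of the inverse transform differ from `1` by at most the average of
`lam * quadMean` at the two points. -/
lemma norm_freePoissonInverse_sub_sub_le {lam : ℝ} (hlam : 0 ≤ lam) (a : Measure ℝ)
    [IsProbabilityMeasure a] {z z' : ℂ} (hz : 0 < z.im) (hz' : 0 < z'.im) :
    ‖freePoissonInverse lam a z - freePoissonInverse lam a z' - (z - z')‖ ≤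
      (lam * quadMean a z + lam * quadMean a z') / 2 * ‖z - z'‖ := by
  have h1 : freePoissonInverse lam a z - freePoissonInverse lam a z' - (z - z') =
      -(lam * (z - z') * ∫ x : ℝ, ((x : ℂ) * (z - x)⁻¹) * ((x : ℂ) * (z' - x)⁻¹) ∂a) := by
    have h2 : freePoissonInverse lam a z - freePoissonInverse lam a z' - (z - z') =
        lam * (z * (z * cauchyTransform a z - 1) - z' * (z' * cauchyTransform a z' - 1)) := by
      unfold freePoissonInverse; ring
    rw [h2, mul_cauchyTransform_sub_one a hz, mul_cauchyTransform_sub_one a hz',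
      ← integral_const_mul z, ← integral_const_mul z', ← integral_sub
        ((integrable_mul_inv_sub a hz).const_mul z) ((integrable_mul_inv_sub a hz').const_mul z'),
      mul_assoc, ← mul_neg, ← integral_const_mul (z - z'), ← integral_neg]
    congr 1
    refine integral_congr_ae (ae_of_all _ fun x => ?_)
    have h2 := sub_ofReal_ne_zero hz x
    have h3 := sub_ofReal_ne_zero hz' x
    field_simp
    ring
  have h2 : ‖∫ x : ℝ, ((x : ℂ) * (z - x)⁻¹) * ((x : ℂ) * (z' - x)⁻¹) ∂a‖ ≤
      (quadMean a z + quadMean a z') / 2 := by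
    have hi := integrable_norm_mul_inv_sub_sq a hz
    have hi' := integrable_norm_mul_inv_sub_sq a hz'
    rw [quadMean, quadMean, ← integral_add hi hi', ← integral_div]
    refine norm_integral_le_of_norm_le ((hi.add hi').div_const 2) (ae_of_all _ fun x => ?_)
    rw [norm_mul]
    nlinarith [sq_nonneg (‖(x : ℂ) * (z - x)⁻¹‖ - ‖(x : ℂ) * (z' - x)⁻¹‖)]
  rw [h1, norm_neg, norm_mul, norm_mul, Complex.norm_real, Real.norm_eq_abs, abs_of_nonneg hlam]
  have := mul_le_mul_of_nonneg_left h2 (mul_nonneg hlam (norm_nonneg (z - z')))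
  nlinarith

lemma mul_quadMean_lt_one {lam : ℝ} {a : Measure ℝ} [IsProbabilityMeasure a] {z : ℂ}
    (hz : 0 < z.im) (h : 0 < (freePoissonInverse lam a z).im) : lam * quadMean a z < 1 := by
  rw [im_freePoissonInverse lam a hz] at h
  have := pos_of_mul_pos_right h hz.le
  linarith

lemma quadMean_nonneg (a : Measure ℝ) (z : ℂ) : 0 ≤ quadMean a z :=
  integral_nonneg fun _ => by positivity

/-- The inverse transform is injective on the part of the upper half-plane that it maps into the
upper half-plane. -/
lemma freePoissonInverse_injOn {lam : ℝ} (hlam : 0 ≤ lam) (a : Measure ℝ)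
    [IsProbabilityMeasure a] {z z' : ℂ} (hz : 0 < z.im) (hz' : 0 < z'.im)
    (h : 0 < (freePoissonInverse lam a z).im)
    (heq : freePoissonInverse lam a z = freePoissonInverse lam a z') : z = z' := by
  have h1 := norm_freePoissonInverse_sub_sub_le hlam a hz hz'
  have h2 := mul_quadMean_lt_one hz h
  have h3 := mul_quadMean_lt_one hz' (heq ▸ h)
  rw [heq, sub_self, zero_sub, norm_neg] at h1
  by_contra hne
  have h4 : 0 < ‖z - z'‖ := norm_pos_iff.2 (sub_ne_zero.2 hne)
  nlinarith

/-- If the derivative vanished at `z`, letting `z' → z` in the estimate of the divided differences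
would give `1 ≤ lam * quadMean a z`. -/
lemma deriv_freePoissonInverse_ne_zero {lam : ℝ} (hlam : 0 ≤ lam) (a : Measure ℝ)
    [IsProbabilityMeasure a] {z : ℂ} (hz : 0 < z.im)
    (h : 0 < (freePoissonInverse lam a z).im) : deriv (freePoissonInverse lam a) z ≠ 0 := by
  intro h0
  have hd : DifferentiableAt ℂ (freePoissonInverse lam a) z :=
    (differentiableOn_freePoissonInverse lam a).differentiableAt
      (isOpen_upperHalfPlane.mem_nhds hz)
  have hslope := hd.hasDerivAt.tendsto_slope
  rw [h0] at hslope
  have hV : Tendsto (fun z' : ℂ => ((1 - (freePoissonInverse lam a z').im / z'.im) +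
      lam * quadMean a z) / 2) (𝓝[≠] z)
      (𝓝 (((1 - (freePoissonInverse lam a z).im / z.im) + lam * quadMean a z) / 2)) := by
    refine Tendsto.mono_left ?_ nhdsWithin_le_nhds
    have h1 : ContinuousAt (fun z' : ℂ => (freePoissonInverse lam a z').im) z :=
      Complex.continuous_im.continuousAt.comp hd.continuousAt
    exact (((h1.div Complex.continuous_im.continuousAt hz.ne').const_sub 1).add_const _).div_const 2
  have hle := le_of_tendsto_of_tendsto ((hslope.sub_const 1).norm) hV ?_
  · have h2 := mul_quadMean_lt_one hz h
    rw [im_freePoissonInverse lam a hz, mul_div_cancel_left₀ _ hz.ne'] at hle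
    simp at hle
    linarith
  · filter_upwards [self_mem_nhdsWithin,
      nhdsWithin_le_nhds (isOpen_upperHalfPlane.mem_nhds hz)] with z' hne hz'
    have hz' : 0 < z'.im := hz'
    have h1 := norm_freePoissonInverse_sub_sub_le hlam a hz' hz
    have hne' : z' - z ≠ 0 := sub_ne_zero.2 hne
    rw [im_freePoissonInverse lam a hz', mul_div_cancel_left₀ _ hz'.ne', slope_def_field,
      div_sub_one hne', norm_div, div_le_iff₀ (norm_pos_iff.2 hne')]
    refine h1.trans_eq ?_
    ring

lemma exists_measureReal_tail_le (a : Measure ℝ) [IsFiniteMeasure a] {δ : ℝ} (hδ : 0 < δ) :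
    ∃ A : ℝ, 0 < A ∧ a.real {x | A < |x|} ≤ δ := by
  have h1 : Tendsto (fun n : ℕ => a.real {x : ℝ | (n : ℝ) + 1 < |x|}) atTop (𝓝 0) := by
    have hemp : (⋂ n : ℕ, {x : ℝ | (n : ℝ) + 1 < |x|}) = ∅ := by
      ext x
      simp only [mem_iInter, mem_ofPred_eq, mem_empty_iff_false, iff_false, not_forall, not_lt]
      obtain ⟨n, hn⟩ := exists_nat_ge |x|
      exact ⟨n, by linarith⟩
    have h2 := tendsto_measure_iInter_atTop (μ := a) (s := fun n : ℕ => {x : ℝ | (n : ℝ) + 1 < |x|})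
      (fun n => (measurableSet_lt measurable_const measurable_norm).nullMeasurableSet)
      (fun n k hnk x hx => by
        have : (n : ℝ) ≤ k := by exact_mod_cast hnk
        simp only [mem_ofPred_eq] at hx ⊢
        linarith) ⟨0, measure_ne_top _ _⟩
    rw [hemp, measure_empty] at h2
    exact (ENNReal.tendsto_toReal ENNReal.zero_ne_top).comp h2
  obtain ⟨n, hn⟩ := (h1.eventually (ge_mem_nhds hδ)).exists
  exact ⟨n + 1, by positivity, hn⟩

lemma norm_mul_cauchyTransform_sub_one_le (a : Measure ℝ) [IsProbabilityMeasure a] {z : ℂ}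
    (hz : 0 < z.im) {A : ℝ} {g : ℝ → ℝ} (hg : Integrable g a) {C : ℝ}
    (h : ∀ x : ℝ, ‖(x : ℂ) * (z - x)⁻¹‖ ≤ g x + {x | A < |x|}.indicator (fun _ => C) x) :
    ‖z * cauchyTransform a z - 1‖ ≤ ∫ x, g x ∂a + C * a.real {x | A < |x|} := by
  have hm : MeasurableSet {x : ℝ | A < |x|} := measurableSet_lt measurable_const measurable_norm
  have hi : Integrable ({x : ℝ | A < |x|}.indicator (fun _ => C)) a :=
    (integrable_const C).indicator hm
  rw [mul_cauchyTransform_sub_one a hz]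
  refine (norm_integral_le_of_norm_le (hg.add hi) (ae_of_all _ h)).trans_eq ?_
  simp only [Pi.add_apply]
  rw [integral_add hg hi, integral_indicator_const C hm, smul_eq_mul, mul_comm]

/-- `z G_a(z) → 1` as `z → ∞` in a cone. -/
lemma exists_cone_norm_le (a : Measure ℝ) [IsProbabilityMeasure a] {η ε : ℝ} (hη : 0 < η)
    (hε : 0 < ε) : ∃ M : ℝ, 0 < M ∧ ∀ M' ≥ M, ∀ z ∈ truncCone η M',
      ‖z * cauchyTransform a z - 1‖ ≤ ε := by
  set C : ℝ := 2 + 1 / η with hC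
  have hC0 : 0 < C := by positivity
  obtain ⟨A, hA, htail⟩ := exists_measureReal_tail_le a (δ := ε / (2 * C)) (by positivity)
  refine ⟨2 * A / ε, by positivity, fun M' hM' z hz => ?_⟩
  obtain ⟨hz1, hz2⟩ := hz
  have hM : 2 * A / ε < z.im := lt_of_le_of_lt hM' hz1
  have hz0 : 0 < z.im := lt_trans (by positivity) hM
  rw [abs_of_pos hz0] at hz2
  have hnorm : ‖z‖ / z.im ≤ 1 + 1 / η := by
    rw [div_le_iff₀ hz0]
    have h1 := Complex.norm_le_abs_re_add_abs_im z
    rw [abs_of_pos hz0] at h1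
    have h2 : |z.re| ≤ 1 / η * z.im := by
      rw [div_mul_eq_mul_div, one_mul, le_div_iff₀ hη]; linarith
    linarith
  have hAz : A / z.im ≤ ε / 2 := by
    rw [div_lt_iff₀ hε] at hM
    rw [div_le_iff₀ hz0]
    linarith
  have h := norm_mul_cauchyTransform_sub_one_le a hz0 (A := A) (g := fun _ => ε / 2)
    (integrable_const _) (C := C) fun x => by
      by_cases hx : A < |x|
      · rw [indicator_of_mem (by exact hx)]
        have := norm_mul_inv_sub_le hz0 x
        linarith
      · rw [indicator_of_notMem (by exact hx), add_zero]
        refine le_trans ?_ hAz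
        rw [norm_mul, Complex.norm_real, Real.norm_eq_abs, div_eq_mul_inv]
        exact mul_le_mul (not_lt.1 hx) (norm_inv_sub_ofReal_le hz0 x) (norm_nonneg _) hA.le
  refine h.trans ?_
  have h2 : C * a.real {x | A < |x|} ≤ C * (ε / (2 * C)) := mul_le_mul_of_nonneg_left htail hC0.le
  have h3 : C * (ε / (2 * C)) = ε / 2 := by field_simp
  simp
  linarith

/-- Where the inverse transform takes values in the upper half-plane it is asymptotic to the
identity, without any nontangential restriction: `x / (z - x)` is bounded in `L²(a)`, hence
uniformly integrable, and it tends to `0` pointwise. -/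
lemma exists_norm_le_of_im_pos {lam : ℝ} (hlam : 0 ≤ lam) (a : Measure ℝ)
    [IsProbabilityMeasure a] {ε : ℝ} (hε : 0 < ε) :
    ∃ R : ℝ, 0 < R ∧ ∀ z : ℂ, 0 < z.im → 0 < (freePoissonInverse lam a z).im → R ≤ ‖z‖ →
      lam * ‖z * cauchyTransform a z - 1‖ ≤ ε := by
  obtain ⟨A, hA, htail⟩ := exists_measureReal_tail_le a (δ := ε ^ 2 / (2 * (lam + 1)))
    (by positivity)
  refine ⟨A + 4 * (lam + 1) * A / ε, by positivity, fun z hz him hR => ?_⟩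
  have hV := mul_quadMean_lt_one hz him
  have hgap : 0 < ‖z‖ - A := by
    have : 0 < 4 * (lam + 1) * A / ε := by positivity
    linarith
  have hsmall : A / (‖z‖ - A) ≤ ε / (4 * (lam + 1)) := by
    rw [div_le_div_iff₀ hgap (by positivity)]
    have : 4 * (lam + 1) * A / ε ≤ ‖z‖ - A := by linarith
    rw [div_le_iff₀ hε] at this
    linarith
  have hq := integrable_norm_mul_inv_sub_sq a hz
  have h := norm_mul_cauchyTransform_sub_one_le a hz (A := A)
    (g := fun x => A / (‖z‖ - A) + ε / 2 * ‖(x : ℂ) * (z - x)⁻¹‖ ^ 2)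
    ((integrable_const _).add (hq.const_mul _)) (C := 1 / (2 * ε)) fun x => by
      set t := ‖(x : ℂ) * (z - x)⁻¹‖ with ht
      by_cases hx : A < |x|
      · rw [indicator_of_mem (by exact hx)]
        have h1 : 0 ≤ A / (‖z‖ - A) := by positivity
        -- Young's inequality trades the tail for the quadratic mean.
        have h2 : t ≤ ε / 2 * t ^ 2 + 1 / (2 * ε) := by
          have h3 : ε / 2 * t ^ 2 + 1 / (2 * ε) - t = (ε * t - 1) ^ 2 / (2 * ε) := by
            field_simp
            ring
          have : 0 ≤ (ε * t - 1) ^ 2 / (2 * ε) := by positivity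
          linarith
        linarith
      · rw [indicator_of_notMem (by exact hx), add_zero]
        have h1 : 0 ≤ ε / 2 * t ^ 2 := by positivity
        have h2 : t ≤ A / (‖z‖ - A) := by
          have hx' := not_lt.1 hx
          have h3 : ‖z‖ - A ≤ ‖z - x‖ := by
            have := norm_sub_norm_le z (x : ℂ)
            rw [Complex.norm_real, Real.norm_eq_abs] at this
            linarith
          rw [ht, norm_mul, norm_inv, Complex.norm_real, Real.norm_eq_abs, ← div_eq_mul_inv]
          exact div_le_div₀ hA.le hx' hgap h3
        linarith
  rw [integral_add (integrable_const _) (hq.const_mul _), integral_const_mul] at h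
  simp only [integral_const, probReal_univ, one_smul] at h
  change _ ≤ A / (‖z‖ - A) + ε / 2 * quadMean a z + _ at h
  have h1 := mul_le_mul_of_nonneg_left h hlam
  have h2 : lam * (A / (‖z‖ - A)) ≤ ε / 4 := by
    have := mul_le_mul_of_nonneg_left hsmall hlam
    refine this.trans ?_
    rw [mul_div_assoc', div_le_div_iff₀ (by positivity) (by norm_num)]
    nlinarith
  have h3 : lam * (1 / (2 * ε) * a.real {x | A < |x|}) ≤ ε / 4 := by
    calc lam * (1 / (2 * ε) * a.real {x | A < |x|})
        ≤ lam * (1 / (2 * ε) * (ε ^ 2 / (2 * (lam + 1)))) := by gcongr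
      _ = ε * lam / (4 * (lam + 1)) := by field_simp; ring
      _ ≤ ε / 4 := by
        rw [div_le_div_iff₀ (by positivity) (by norm_num)]
        nlinarith
  nlinarith

/-- The inverse transform maps a subset of the upper half-plane onto the upper half-plane: the
image is nonempty, open, and closed because preimages of bounded sets are bounded. -/
theorem exists_freePoissonInverse_eq {lam : ℝ} (hlam : 0 ≤ lam) (a : Measure ℝ)
    [IsProbabilityMeasure a] {w : ℂ} (hw : 0 < w.im) :
    ∃ z : ℂ, 0 < z.im ∧ freePoissonInverse lam a z = w := by
  set S : Set ℂ := {w | 0 < w.im ∧ ∃ z : ℂ, 0 < z.im ∧ freePoissonInverse lam a z = w} with hS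
  have hdiff : ∀ z : ℂ, 0 < z.im → AnalyticAt ℂ (freePoissonInverse lam a) z := fun z hz =>
    (differentiableOn_freePoissonInverse lam a).analyticAt (isOpen_upperHalfPlane.mem_nhds hz)
  have hopen : IsOpen S := by
    rw [isOpen_iff_mem_nhds]
    rintro w ⟨hw, z, hz, rfl⟩
    have h1 := (hdiff z hz).hasStrictDerivAt.map_nhds_eq
      (deriv_freePoissonInverse_ne_zero hlam a hz hw)
    have h2 := image_mem_map (m := freePoissonInverse lam a) (isOpen_upperHalfPlane.mem_nhds hz)
    rw [h1] at h2
    filter_upwards [isOpen_upperHalfPlane.mem_nhds hw, h2] with w hw hw'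
    exact ⟨hw, hw'⟩
  have hne : ({w : ℂ | 0 < w.im} ∩ S).Nonempty := by
    obtain ⟨M, hM, h⟩ := exists_cone_norm_le a one_pos (ε := 1 / (2 * (lam + 1))) (by positivity)
    set z : ℂ := ((M + 1 : ℝ) : ℂ) * Complex.I with hz
    have hzim : z.im = M + 1 := by simp [hz]
    have hzre : z.re = 0 := by simp [hz]
    have h1 := h M le_rfl z ⟨by rw [hzim]; linarith, by
      rw [hzim, hzre, abs_zero, abs_of_pos (by linarith)]; linarith⟩
    have him : 0 < (freePoissonInverse lam a z).im := by
      have h2 : (freePoissonInverse lam a z).im =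
          (M + 1) * (1 + lam * (z * cauchyTransform a z - 1).re) := by
        rw [freePoissonInverse, Complex.mul_im, hzre, hzim]
        simp
      have h3 := (abs_le.1 ((Complex.abs_re_le_norm _).trans h1)).1
      have h4 : lam * (1 / (2 * (lam + 1))) ≤ 1 / 2 := by
        rw [mul_one_div, div_le_div_iff₀ (by positivity) (by norm_num)]
        linarith
      rw [h2]
      have h5 := mul_le_mul_of_nonneg_left h3 hlam
      apply mul_pos (by linarith)
      linarith
    exact ⟨_, him, him, z, by rw [hzim]; linarith, rfl⟩
  have hclosed : closure S ∩ {w : ℂ | 0 < w.im} ⊆ S := by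
    rintro w ⟨hwS, hw⟩
    have hw : 0 < w.im := hw
    obtain ⟨v, hv, hvw⟩ := mem_closure_iff_seq_limit.1 hwS
    choose hvim z hz hzv using hv
    obtain ⟨R, hR, hbd⟩ := exists_norm_le_of_im_pos hlam a (ε := 1 / 2) (by norm_num)
    -- The preimages `z n` stay bounded and at positive distance from the real line.
    have hzbound : ∀ n, ‖z n‖ ≤ max R (2 * ‖v n‖) := by
      intro n
      by_cases hn : R ≤ ‖z n‖
      · have h1 := hbd (z n) (hz n) (by rw [hzv]; exact hvim n) hn
        refine le_max_of_le_right ?_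
        have h2 : z n = v n - z n * (lam * (z n * cauchyTransform a (z n) - 1)) := by
          rw [← hzv n, freePoissonInverse]; ring
        have h3 : ‖z n‖ ≤ ‖v n‖ + ‖z n‖ * (lam * ‖z n * cauchyTransform a (z n) - 1‖) := by
          calc ‖z n‖ = ‖v n - z n * (lam * (z n * cauchyTransform a (z n) - 1))‖ := by rw [← h2]
            _ ≤ ‖v n‖ + ‖z n * (lam * (z n * cauchyTransform a (z n) - 1))‖ := norm_sub_le _ _
            _ = _ := by
              rw [norm_mul, norm_mul, Complex.norm_real, Real.norm_eq_abs, abs_of_nonneg hlam]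
        nlinarith [norm_nonneg (z n)]
      · exact le_max_of_le_left (not_le.1 hn).le
    have hzim : ∀ n, (v n).im ≤ (z n).im := by
      intro n
      rw [← hzv n, im_freePoissonInverse lam a (hz n)]
      have := mul_nonneg hlam (quadMean_nonneg a (z n))
      nlinarith [hz n]
    have hev : ∀ᶠ n in atTop, z n ∈ closedBall (0 : ℂ) (max R (2 * (‖w‖ + 1))) ∩
        {z : ℂ | w.im / 2 ≤ z.im} := by
      have h1 : ∀ᶠ n in atTop, ‖v n‖ < ‖w‖ + 1 :=
        hvw.norm.eventually (gt_mem_nhds (by linarith))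
      have h2 : ∀ᶠ n in atTop, w.im / 2 < (v n).im :=
        ((Complex.continuous_im.tendsto w).comp hvw).eventually (lt_mem_nhds (by linarith))
      filter_upwards [h1, h2] with n h1 h2
      refine ⟨?_, h2.le.trans (hzim n)⟩
      rw [mem_closedBall, dist_zero_right]
      refine (hzbound n).trans (max_le_max le_rfl ?_)
      linarith
    have hcpt : IsCompact (closedBall (0 : ℂ) (max R (2 * (‖w‖ + 1))) ∩
        {z : ℂ | w.im / 2 ≤ z.im}) :=
      (isCompact_closedBall _ _).inter_right (isClosed_le continuous_const Complex.continuous_im)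
    obtain ⟨z₀, hz₀, φ, hφ, hlim⟩ := hcpt.tendsto_subseq' hev.frequently
    have hz₀im : 0 < z₀.im := lt_of_lt_of_le (by linarith) hz₀.2
    refine ⟨hw, z₀, hz₀im, ?_⟩
    have h1 := (hdiff z₀ hz₀im).continuousAt.tendsto.comp hlim
    have h2 := hvw.comp hφ.tendsto_atTop
    refine tendsto_nhds_unique h1 (h2.congr fun n => ?_)
    simp [hzv]
  exact (isPreconnected_upperHalfPlane.subset_of_closure_inter_subset hopen hne hclosed hw).2

/-! ### Free compound Poisson laws -/

/-- `μ` is a probability measure whose reciprocal Cauchy transform is the right inverse, from the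
upper half-plane to itself, of `freePoissonInverse lam a`: the form in which the free compound
Poisson law with rate `lam` and jump distribution `a` is handled. -/
structure HasFreePoissonInverse (lam : ℝ) (a μ : Measure ℝ) : Prop where
  prob : IsProbabilityMeasure μ
  im_pos : ∀ w : ℂ, 0 < w.im → 0 < (recipCauchy μ w).im
  inverse_eq : ∀ w : ℂ, 0 < w.im → freePoissonInverse lam a (recipCauchy μ w) = w

/-- Free compound Poisson laws exist: the right inverse of `freePoissonInverse lam a` is holomorphic
by the inverse function theorem and asymptotic to the identity along `iy`. -/
theorem exists_hasFreePoissonInverse {lam : ℝ} (hlam : 0 ≤ lam) (a : Measure ℝ)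
    [IsProbabilityMeasure a] : ∃ μ : Measure ℝ, HasFreePoissonInverse lam a μ := by
  choose! F hF hHF using fun (w : ℂ) (hw : 0 < w.im) => exists_freePoissonInverse_eq hlam a hw
  have hinv : ∀ z : ℂ, 0 < z.im → 0 < (freePoissonInverse lam a z).im →
      F (freePoissonInverse lam a z) = z := fun z hz h =>
    freePoissonInverse_injOn hlam a (hF _ h) hz (by rwa [hHF _ h]) (hHF _ h)
  have hFne : ∀ w : ℂ, 0 < w.im → F w ≠ 0 := fun w hw h0 => by
    have := hF w hw
    simp [h0] at this
  have hFim : ∀ w : ℂ, 0 < w.im → w.im ≤ (F w).im := by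
    intro w hw
    have h1 := im_freePoissonInverse lam a (hF w hw)
    rw [hHF w hw] at h1
    have := mul_nonneg hlam (quadMean_nonneg a (F w))
    nlinarith [hF w hw]
  have hFdiff : DifferentiableOn ℂ F {w | 0 < w.im} := by
    intro w hw
    have hw : 0 < w.im := hw
    have han : AnalyticAt ℂ (freePoissonInverse lam a) (F w) :=
      (differentiableOn_freePoissonInverse lam a).analyticAt
        (isOpen_upperHalfPlane.mem_nhds (hF w hw))
    have hev : ∀ᶠ z in 𝓝 (F w), F (freePoissonInverse lam a z) = z := by
      have h1 : ∀ᶠ z in 𝓝 (F w), freePoissonInverse lam a z ∈ {w : ℂ | 0 < w.im} := by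
        refine han.continuousAt.eventually_mem (isOpen_upperHalfPlane.mem_nhds ?_)
        change 0 < (freePoissonInverse lam a (F w)).im
        rwa [hHF w hw]
      filter_upwards [h1, isOpen_upperHalfPlane.mem_nhds (hF w hw)] with z h1 h2
      exact hinv z h2 h1
    have h2 := han.hasStrictDerivAt.to_local_left_inverse
      (deriv_freePoissonInverse_ne_zero hlam a (hF w hw) (by rwa [hHF w hw])) hev
    rw [hHF w hw] at h2
    exact h2.hasDerivAt.differentiableAt.differentiableWithinAt
  have hlim : Tendsto (fun y : ℝ => (y * Complex.I) * (F (y * Complex.I))⁻¹) atTop (𝓝 1) := by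
    rw [Metric.tendsto_atTop]
    intro ε hε
    obtain ⟨R, hR, h⟩ := exists_norm_le_of_im_pos hlam a (ε := ε / 2) (by positivity)
    refine ⟨R, fun y hy => ?_⟩
    have hy0 : 0 < y := hR.trans_le hy
    set w : ℂ := y * Complex.I with hw
    have hwim : w.im = y := by simp [hw]
    have hw0 : 0 < w.im := by rwa [hwim]
    have h1 := h (F w) (hF w hw0) (by rwa [hHF w hw0]) (by
      have h2 := hFim w hw0
      have h3 := Complex.abs_im_le_norm (F w)
      have h4 := le_abs_self (F w).im
      linarith)
    have h2 : w * (F w)⁻¹ - 1 = lam * (F w * cauchyTransform a (F w) - 1) := by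
      have h3 := hHF w hw0
      rw [freePoissonInverse] at h3
      nth_rewrite 1 [← h3]
      have := hFne w hw0
      field_simp
      ring
    rw [dist_eq_norm, h2, norm_mul, Complex.norm_real, Real.norm_eq_abs, abs_of_nonneg hlam]
    linarith
  obtain ⟨μ, hμ, hG⟩ := exists_cauchyTransform_eq (G := fun w => (F w)⁻¹)
    (hFdiff.inv hFne) (fun z hz => by
      rw [Complex.inv_im]
      exact div_nonpos_of_nonpos_of_nonneg (neg_nonpos.2 (hF z hz).le) (Complex.normSq_nonneg _))
    hlim
  have hrec : ∀ w : ℂ, 0 < w.im → recipCauchy μ w = F w := fun w hw => by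
    rw [recipCauchy, hG w hw, inv_inv]
  exact ⟨μ, hμ, fun w hw => by rw [hrec w hw]; exact hF w hw,
    fun w hw => by rw [hrec w hw]; exact hHF w hw⟩

lemma im_pos_of_mem_truncCone {η M : ℝ} (hM : 0 < M) {z : ℂ} (hz : z ∈ truncCone η M) :
    0 < z.im := hM.trans hz.1

lemma im_pos_of_mem_voiculescuDomain {μ : Measure ℝ} {z : ℂ} (hz : z ∈ voiculescuDomain μ) :
    0 < z.im := by
  obtain ⟨η, M, η', M', h, hz⟩ := hz
  exact im_pos_of_mem_truncCone h.M'_pos hz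

namespace HasFreePoissonInverse

variable {lam : ℝ} {a μ : Measure ℝ}

lemma voiculescu_eq (h : HasFreePoissonInverse lam a μ) {z : ℂ} (hz : z ∈ voiculescuDomain μ) :
    voiculescu μ z = freePoissonInverse lam a z - z := by
  have hex : ∃ w, IsInverseValue μ z w := by
    obtain ⟨η, M, η', M', hinv, hz⟩ := hz
    obtain ⟨w, hw, hwz⟩ := hinv.subset_image hz
    exact ⟨w, η, M, η', M', hinv, hz, hw, hwz⟩
  rw [voiculescu, dif_pos hex]
  obtain ⟨η, M, η', M', hinv, -, hw, hwz⟩ := hex.choose_spec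
  have h1 := h.inverse_eq _ (im_pos_of_mem_truncCone hinv.M_pos hw)
  rw [hwz] at h1
  rw [h1]

/-- The Voiculescu transform is defined far out in every cone. -/
lemma exists_truncCone_subset (hlam : 0 ≤ lam) [IsProbabilityMeasure a]
    (h : HasFreePoissonInverse lam a μ) {η : ℝ} (hη : 0 < η) :
    ∃ M : ℝ, 0 < M ∧ ∀ M' ≥ M, truncCone η M' ⊆ voiculescuDomain μ := by
  set C : ℝ := 1 + 1 / η with hC
  have hC0 : 0 < C := by positivity
  -- On the cone `|z| ≤ C Im z`; the choice of `δ` makes a displacement of size `δ |z|` at most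
  -- `Im z / 4`, also after multiplication by `η`, so that it stays in the cone of aperture `η / 2`.
  set δ : ℝ := 1 / (4 * C * (1 + η)) with hδ
  have hδ0 : 0 < δ := by positivity
  obtain ⟨M, hM, hcone⟩ := exists_cone_norm_le a hη (ε := δ / (lam + 1)) (by positivity)
  refine ⟨max M 2, by positivity, fun M' hM' z hz =>
    ⟨η / 2, 1, η, M', ⟨by positivity, one_pos, hη, ?_, ?_, ?_⟩, hz⟩⟩
  · exact lt_of_lt_of_le (by positivity) hM'
  · intro w hw w' hw' hww
    rw [← h.inverse_eq w (im_pos_of_mem_truncCone one_pos hw), hww,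
      h.inverse_eq w' (im_pos_of_mem_truncCone one_pos hw')]
  · intro z hz
    have h1 := hcone M' ((le_max_left _ _).trans hM') z hz
    obtain ⟨hz1, hz2⟩ := hz
    have hz3 : 2 < z.im := lt_of_le_of_lt ((le_max_right _ _).trans hM') hz1
    have hz0 : 0 < z.im := by linarith
    rw [abs_of_pos hz0] at hz2
    have hre : |z.re| ≤ 1 / η * z.im := by
      rw [div_mul_eq_mul_div, one_mul, le_div_iff₀ hη]; linarith
    have hnorm : ‖z‖ ≤ C * z.im := by
      have h1 := Complex.norm_le_abs_re_add_abs_im z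
      rw [abs_of_pos hz0] at h1
      rw [hC]; linarith
    set d : ℂ := z * (lam * (z * cauchyTransform a z - 1)) with hd
    have hHd : freePoissonInverse lam a z = z + d := by
      rw [freePoissonInverse, hd]; ring
    have hdn : ‖d‖ ≤ z.im / (4 * (1 + η)) := by
      rw [hd, norm_mul, norm_mul, Complex.norm_real, Real.norm_eq_abs, abs_of_nonneg hlam]
      have h2 : lam * ‖z * cauchyTransform a z - 1‖ ≤ δ := by
        calc lam * ‖z * cauchyTransform a z - 1‖ ≤ lam * (δ / (lam + 1)) := by gcongr
          _ ≤ δ := by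
            rw [mul_div_assoc', div_le_iff₀ (by positivity)]
            nlinarith
      calc ‖z‖ * (lam * ‖z * cauchyTransform a z - 1‖) ≤ (C * z.im) * δ := by gcongr
        _ = z.im / (4 * (1 + η)) := by rw [hδ]; field_simp
    have hd4 : ‖d‖ ≤ z.im / 4 := hdn.trans (by gcongr; linarith)
    have hdη : η * ‖d‖ ≤ z.im / 4 := by
      calc η * ‖d‖ ≤ η * (z.im / (4 * (1 + η))) := by gcongr
        _ ≤ z.im / 4 := by
          rw [mul_div_assoc', div_le_div_iff₀ (by positivity) (by norm_num)]
          nlinarith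
    have hdim := abs_le.1 ((Complex.abs_im_le_norm d).trans hd4)
    have him : (freePoissonInverse lam a z).im = z.im + d.im := by rw [hHd, Complex.add_im]
    have hpos : 0 < (freePoissonInverse lam a z).im := by rw [him]; linarith
    refine ⟨freePoissonInverse lam a z, ⟨by rw [him]; linarith, ?_⟩, ?_⟩
    · rw [abs_of_pos hpos, him, hHd, Complex.add_re]
      have h3 : |z.re + d.re| ≤ |z.re| + ‖d‖ :=
        (abs_add_le _ _).trans (add_le_add_right (Complex.abs_re_le_norm d) _)
      nlinarith
    · have h4 := h.im_pos _ hpos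
      have h5 := h.inverse_eq _ hpos
      exact freePoissonInverse_injOn hlam a h4 hz0 (by rwa [h5]) h5

end HasFreePoissonInverse

lemma recipCauchy_dirac_zero (z : ℂ) : recipCauchy (Measure.dirac 0) z = z := by
  simp [recipCauchy, cauchyTransform]

lemma hasFreePoissonInverse_dirac_zero (a : Measure ℝ) :
    HasFreePoissonInverse 0 a (Measure.dirac 0) where
  prob := inferInstance
  im_pos w hw := by rwa [recipCauchy_dirac_zero]
  inverse_eq w hw := by simp [recipCauchy_dirac_zero, freePoissonInverse]

/-- The rates of free compound Poisson laws with a common jump distribution add up under free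
convolution. -/
lemma HasFreePoissonInverse.isFreeConv {l₁ l₂ : ℝ} (h₁ : 0 ≤ l₁) (h₂ : 0 ≤ l₂) {a μ ν ρ : Measure ℝ}
    [IsProbabilityMeasure a] (hμ : HasFreePoissonInverse l₁ a μ)
    (hν : HasFreePoissonInverse l₂ a ν) (hρ : HasFreePoissonInverse (l₁ + l₂) a ρ) :
    IsFreeConv μ ν ρ := by
  obtain ⟨M₁, hM₁, hd₁⟩ := hμ.exists_truncCone_subset h₁ one_pos
  obtain ⟨M₂, hM₂, hd₂⟩ := hν.exists_truncCone_subset h₂ one_pos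
  obtain ⟨M₃, hM₃, hd₃⟩ := hρ.exists_truncCone_subset (add_nonneg h₁ h₂) one_pos
  have hs₁ := hd₁ (max M₁ (max M₂ M₃)) (by simp)
  have hs₂ := hd₂ (max M₁ (max M₂ M₃)) (by simp)
  have hs₃ := hd₃ (max M₁ (max M₂ M₃)) (by simp)
  refine ⟨hμ.prob, hν.prob, hρ.prob, 1, max M₁ (max M₂ M₃), one_pos, by positivity,
    fun z hz => ⟨⟨hs₁ hz, hs₂ hz⟩, hs₃ hz⟩, fun z hz => ?_⟩
  rw [hμ.voiculescu_eq (hs₁ hz), hν.voiculescu_eq (hs₂ hz), hρ.voiculescu_eq (hs₃ hz)]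
  simp only [freePoissonInverse]
  push_cast
  ring

lemma HasFreePoissonInverse.isFreeConvPow {l : ℝ} (hl : 0 ≤ l) {a ν : Measure ℝ}
    [IsProbabilityMeasure a] (hν : HasFreePoissonInverse l a ν) (n : ℕ) :
    ∀ {ρ : Measure ℝ}, HasFreePoissonInverse ((n + 1 : ℕ) * l) a ρ → IsFreeConvPow ν (n + 1) ρ := by
  induction n with
  | zero =>
    intro ρ hρ
    refine ⟨_, rfl, (hasFreePoissonInverse_dirac_zero a).isFreeConv le_rfl hl hν ?_⟩
    simpa using hρ
  | succ n ih =>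
    intro ρ hρ
    have hnl : 0 ≤ ((n + 1 : ℕ) : ℝ) * l := by positivity
    obtain ⟨σ, hσ⟩ := exists_hasFreePoissonInverse hnl a
    refine ⟨σ, ih hσ, hσ.isFreeConv hnl hl hν ?_⟩
    convert hρ using 1
    push_cast
    ring

/-- Free compound Poisson laws are freely infinitely divisible: an `n`-th convolution root is
obtained by dividing the rate by `n`. -/
theorem HasFreePoissonInverse.isFreelyInfDiv {lam : ℝ} (hlam : 0 ≤ lam) {a μ : Measure ℝ}
    [IsProbabilityMeasure a] (h : HasFreePoissonInverse lam a μ) : IsFreelyInfDiv μ := by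
  refine ⟨h.prob, fun n hn => ?_⟩
  obtain ⟨k, rfl⟩ : ∃ k, n = k + 1 := ⟨n - 1, by omega⟩
  have hl : 0 ≤ lam / (k + 1 : ℕ) := by positivity
  obtain ⟨ν, hν⟩ := exists_hasFreePoissonInverse hl a
  refine ⟨ν, hν.prob, hν.isFreeConvPow hl k ?_⟩
  rwa [mul_div_cancel₀]
  positivity

namespace HasFreePoissonInverse

variable {a μ : Measure ℝ}

lemma voiculescu_eq_sq_mul_sub (h : HasFreePoissonInverse 1 a μ) {z : ℂ}
    (hz : z ∈ voiculescuDomain μ) : voiculescu μ z = z ^ 2 * cauchyTransform a z - z := by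
  rw [h.voiculescu_eq hz, freePoissonInverse]
  push_cast
  ring

lemma rTransform_eq_integral (h : HasFreePoissonInverse 1 a μ) [IsProbabilityMeasure a] {z : ℂ}
    (hz : z⁻¹ ∈ voiculescuDomain μ) :
    rTransform μ z = ∫ x : ℝ, (x : ℂ) * (z⁻¹ - x)⁻¹ ∂a := by
  have him := im_pos_of_mem_voiculescuDomain hz
  have hz0 : z ≠ 0 := by
    rintro rfl
    simp at him
  rw [rTransform, h.voiculescu_eq_sq_mul_sub hz, ← mul_cauchyTransform_sub_one a him]
  field_simp

lemma mul_div_one_sub_mul {z : ℂ} (hz : 0 < (z⁻¹).im) (x : ℝ) :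
    z * x / (1 - z * x) = x * (z⁻¹ - x)⁻¹ := by
  have hz0 : z ≠ 0 := by
    rintro rfl
    simp at hz
  have h1 := sub_ofReal_ne_zero hz x
  have h2 : 1 - z * x = z * (z⁻¹ - x) := by field_simp
  rw [h2, mul_div_mul_left _ _ hz0, div_eq_mul_inv]

lemma rTransform_eq_psiTransform (h : HasFreePoissonInverse 1 a μ) [IsProbabilityMeasure a]
    {z : ℂ} (hz : z⁻¹ ∈ voiculescuDomain μ) : rTransform μ z = psiTransform a z := by
  rw [h.rTransform_eq_integral hz, psiTransform]
  exact integral_congr_ae (ae_of_all _ fun x =>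
    (mul_div_one_sub_mul (im_pos_of_mem_voiculescuDomain hz) x).symm)

/-- The jump distribution is the Lévy measure; the drift compensates the truncated first moment. -/
lemma isFreeLevyMeasure (h : HasFreePoissonInverse 1 a μ) [IsProbabilityMeasure a]
    (ha : a {0} = 0) : IsFreeLevyMeasure μ a := by
  have hS : MeasurableSet {y : ℝ | |y| ≤ 1} := measurableSet_le measurable_norm measurable_const
  refine ⟨ha, ?_, ∫ x in {y : ℝ | |y| ≤ 1}, x ∂a, 0, le_rfl, fun z hz => ?_⟩
  · calc ∫⁻ x : ℝ, ENNReal.ofReal (min 1 (x ^ 2)) ∂a ≤ ∫⁻ _ : ℝ, 1 ∂a := by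
          refine lintegral_mono fun x => ?_
          rw [← ENNReal.ofReal_one]
          exact ENNReal.ofReal_le_ofReal (min_le_left _ _)
      _ < ⊤ := by simp
  · have him := im_pos_of_mem_voiculescuDomain hz
    have hi : Integrable (fun x : ℝ => ({y : ℝ | |y| ≤ 1}.indicator (fun y : ℝ => (y : ℂ)) x)) a := by
      refine Integrable.of_bound (C := 1) ?_ (ae_of_all _ fun x => ?_)
      · exact (Complex.measurable_ofReal.indicator hS).aestronglyMeasurable
      · by_cases hx : |x| ≤ 1
        · rw [indicator_of_mem (by exact hx)]
          simpa using hx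
        · rw [indicator_of_notMem (by exact hx)]
          simp
    have hpt : ∀ x : ℝ, (1 / (1 - (x : ℂ) * z) - 1 -
        (x : ℂ) * z * (indicator {y : ℝ | |y| ≤ 1} (fun _ => (1 : ℂ)) x)) =
        (x : ℂ) * (z⁻¹ - x)⁻¹ - z * ({y : ℝ | |y| ≤ 1}.indicator (fun y : ℝ => (y : ℂ)) x) := by
      intro x
      have hz0 : z ≠ 0 := by
        rintro rfl
        simp at him
      have hne : 1 - z * x ≠ 0 := by
        have h2 : 1 - z * x = z * (z⁻¹ - x) := by field_simp
        rw [h2]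
        exact mul_ne_zero hz0 (sub_ofReal_ne_zero him x)
      have h1 : 1 / (1 - (x : ℂ) * z) - 1 = x * (z⁻¹ - x)⁻¹ := by
        rw [← mul_div_one_sub_mul him x, mul_comm (x : ℂ) z, div_sub_one hne]
        ring
      rw [h1]
      by_cases hx : |x| ≤ 1
      · rw [indicator_of_mem (by exact hx), indicator_of_mem (by exact hx)]
        ring
      · rw [indicator_of_notMem (by exact hx), indicator_of_notMem (by exact hx)]
        ring
    simp only [hpt]
    rw [integral_sub (integrable_mul_inv_sub a him) (hi.const_mul _), integral_const_mul,
      ← h.rTransform_eq_integral hz, integral_indicator hS, integral_complex_ofReal]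
    push_cast
    ring

end HasFreePoissonInverse

/-- The mass of the origin is bounded by the Cauchy transform on the imaginary axis. -/
lemma measureReal_singleton_zero_le (a : Measure ℝ) [IsProbabilityMeasure a] {y : ℝ} (hy : 0 < y) :
    a.real {0} ≤ y * ‖cauchyTransform a (y * Complex.I)‖ := by
  have him : (y * Complex.I : ℂ).im = y := by simp
  have hpos : 0 < (y * Complex.I : ℂ).im := by rwa [him]
  have h1 := im_cauchyTransform a hpos
  have hb : ∀ x : ℝ, y ≤ ‖(y * Complex.I : ℂ) - x‖ := fun x => by
    simpa [him] using im_le_norm_sub_ofReal hpos x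
  have hint : Integrable (fun x : ℝ => y / ‖(y * Complex.I : ℂ) - x‖ ^ 2) a := by
    refine Integrable.of_bound (C := y / y ^ 2) ?_ (ae_of_all _ fun x => ?_)
    · refine (Continuous.div (by fun_prop) (by fun_prop) fun x => ?_).aestronglyMeasurable
      have := hy.trans_le (hb x)
      positivity
    · rw [Real.norm_eq_abs, abs_of_nonneg (by positivity)]
      have := hb x
      gcongr
  have h2 : ∫ x in ({0} : Set ℝ), y / ‖(y * Complex.I : ℂ) - x‖ ^ 2 ∂a ≤
      ∫ x : ℝ, y / ‖(y * Complex.I : ℂ) - x‖ ^ 2 ∂a :=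
    setIntegral_le_integral hint (ae_of_all _ fun x => by positivity)
  rw [integral_singleton] at h2
  rw [him] at h1
  have h3 : y / ‖(y * Complex.I : ℂ) - (0 : ℝ)‖ ^ 2 = y⁻¹ := by
    simp [abs_of_pos hy]
    field_simp
  rw [h3, smul_eq_mul] at h2
  have h4 := Complex.abs_im_le_norm (cauchyTransform a (y * Complex.I))
  rw [h1, abs_neg] at h4
  have h5 := (h2.trans (le_abs_self _)).trans h4
  rw [← div_eq_mul_inv, div_le_iff₀ hy] at h5
  linarith

/-! ### Powers with argument in `(0, 2π)` -/

lemma exp_logOne {z : ℂ} (hz : z ≠ 0) : Complex.exp (logOne z) = z := by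
  rw [logOne, Complex.exp_add, Complex.exp_log (neg_ne_zero.2 hz), Complex.exp_pi_mul_I]
  ring

lemma im_logOne (z : ℂ) : (logOne z).im = (-z).arg + Real.pi := by
  simp [logOne, Complex.log_im]

lemma im_logOne_pos (z : ℂ) : 0 < (logOne z).im := by
  rw [im_logOne]
  linarith [Complex.neg_pi_lt_arg (-z)]

lemma im_logOne_le (z : ℂ) : (logOne z).im ≤ 2 * Real.pi := by
  rw [im_logOne]
  linarith [Complex.arg_le_pi (-z)]

lemma logOne_exp {ζ : ℂ} (h0 : 0 < ζ.im) (h1 : ζ.im < 2 * Real.pi) :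
    logOne (Complex.exp ζ) = ζ := by
  have h : -Complex.exp ζ = Complex.exp (ζ - Real.pi * Complex.I) := by
    rw [Complex.exp_sub, Complex.exp_pi_mul_I]
    ring
  rw [logOne, h, Complex.log_exp (by simp; linarith) (by simp; linarith)]
  ring

lemma powOne_exp {ζ : ℂ} (h0 : 0 < ζ.im) (h1 : ζ.im < 2 * Real.pi) (c : ℝ) :
    powOne (Complex.exp ζ) c = Complex.exp (c * ζ) := by
  rw [powOne, logOne_exp h0 h1]

lemma im_log_pos {z : ℂ} (hz : 0 < z.im) : 0 < (Complex.log z).im := by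
  rw [Complex.log_im]
  exact lt_of_le_of_ne (Complex.arg_nonneg_iff.2 hz.le) fun h => by
    rw [eq_comm, Complex.arg_eq_zero_iff] at h
    exact hz.ne' h.2

lemma im_log_lt_pi {z : ℂ} (hz : 0 < z.im) : (Complex.log z).im < Real.pi := by
  rw [Complex.log_im]
  exact lt_of_le_of_ne (Complex.arg_le_pi z) fun h => by
    rw [Complex.arg_eq_pi_iff] at h
    exact hz.ne' h.2

lemma ne_zero_of_im_pos {z : ℂ} (hz : 0 < z.im) : z ≠ 0 := by
  rintro rfl
  simp at hz

lemma powOne_of_im_pos {z : ℂ} (hz : 0 < z.im) (c : ℝ) :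
    powOne z c = Complex.exp (c * Complex.log z) := by
  conv_lhs => rw [← Complex.exp_log (ne_zero_of_im_pos hz)]
  exact powOne_exp (im_log_pos hz) (by linarith [im_log_lt_pi hz, Real.pi_pos]) c

lemma powOne_neg_one (c : ℝ) : powOne (-1) c = Complex.exp (c * (Real.pi * Complex.I)) := by
  rw [← Complex.exp_pi_mul_I, powOne_exp (by simp [Real.pi_pos]) (by simp; linarith [Real.pi_pos])]

lemma powOne_neg_one_div {z : ℂ} (hz : 0 < z.im) (c : ℝ) :
    powOne (-1 / z) c = Complex.exp (c * (Real.pi * Complex.I - Complex.log z)) := by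
  have h : -1 / z = Complex.exp (Real.pi * Complex.I - Complex.log z) := by
    rw [Complex.exp_sub, Complex.exp_pi_mul_I, Complex.exp_log (ne_zero_of_im_pos hz)]
  have h1 := im_log_pos hz
  have h2 := im_log_lt_pi hz
  rw [h, powOne_exp (by simpa using h2) (by simp; linarith [Real.pi_pos])]

lemma neg_mem_slitPlane {z : ℂ} (hz : z ≠ 0) (h : (logOne z).im < 2 * Real.pi) :
    -z ∈ Complex.slitPlane := by
  rw [Complex.mem_slitPlane_iff_arg]
  refine ⟨fun h1 => ?_, neg_ne_zero.2 hz⟩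
  rw [im_logOne, h1] at h
  linarith

lemma differentiableAt_logOne {z : ℂ} (hz : z ≠ 0) (h : (logOne z).im < 2 * Real.pi) :
    DifferentiableAt ℂ logOne z := by
  unfold logOne
  exact (differentiableAt_id.neg.clog (neg_mem_slitPlane hz h)).add_const _

lemma logOne_ofReal_mul {c : ℝ} (hc : 0 < c) {z : ℂ} (hz : z ≠ 0) :
    logOne (c * z) = Real.log c + logOne z := by
  rw [logOne, logOne, ← mul_neg, Complex.log_ofReal_mul hc (neg_ne_zero.2 hz)]
  ring

/-! ### Admissible pairs and sectors -/

namespace Admissible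

variable {α : ℝ} {s : ℂ}

lemma alpha_pos (h : Admissible α s) : 0 < α := by
  rcases h.2 with h | h <;> linarith [h.1]

lemma alpha_le_two (h : Admissible α s) : α ≤ 2 := by
  rcases h.2 with h | h <;> linarith [h.2.1]

lemma arg_nonneg (h : Admissible α s) : 0 ≤ s.arg := by
  rcases h.2 with ⟨-, h1, h2, -⟩ | ⟨-, -, h1, -⟩
  · nlinarith [Real.pi_pos]
  · exact h1

lemma pi_le (h : Admissible α s) : Real.pi ≤ α * Real.pi + s.arg := by
  rcases h.2 with ⟨-, h1, h2, -⟩ | ⟨h1, -, h2, -⟩ <;> nlinarith [Real.pi_pos]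

lemma le_two_pi (h : Admissible α s) : α * Real.pi + s.arg ≤ 2 * Real.pi := by
  rcases h.2 with ⟨-, h1, -, h2⟩ | ⟨-, -, -, h2⟩ <;> nlinarith [Real.pi_pos]

lemma div_four (h : Admissible α s) : Admissible α (s / 4) := by
  have harg : (s / 4).arg = s.arg := by
    have : s / 4 = ((1 / 4 : ℝ) : ℂ) * s := by push_cast; ring
    rw [this, Complex.arg_real_mul _ (by norm_num)]
  refine ⟨div_ne_zero h.1 (by norm_num), ?_⟩
  rw [harg]
  exact h.2

end Admissible

lemma exp_im_mul (ζ : ℂ) (t : ℝ) : (Complex.exp ζ * Complex.exp (-(t * Complex.I))).im =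
    Real.exp ζ.re * Real.sin (ζ.im - t) := by
  rw [← Complex.exp_add, Complex.exp_im]
  simp [sub_eq_add_neg]

lemma exp_re_mul (ζ : ℂ) (t : ℝ) : (Complex.exp ζ * Complex.exp (-(t * Complex.I))).re =
    Real.exp ζ.re * Real.cos (ζ.im - t) := by
  rw [← Complex.exp_add, Complex.exp_re]
  simp [sub_eq_add_neg]

/-- For an admissible pair, `z ^ α - e^{iπα} s` lies in the open sector `0 < arg < απ`. For
`α ≤ 1` this is because that sector is convex; for `α > 1` because the complementary closed sector
`απ ≤ arg ≤ 2π` is convex, which also covers the half-line for `α = 2`. Here `z ^ α = e^ζ`. -/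
lemma im_logOne_exp_sub_lt {α : ℝ} {s : ℂ} (h : Admissible α s) {ζ : ℂ} (h0 : 0 < ζ.im)
    (h1 : ζ.im < α * Real.pi) :
    Complex.exp ζ - Complex.exp ((α * Real.pi : ℝ) * Complex.I) * s ≠ 0 ∧
      (logOne (Complex.exp ζ - Complex.exp ((α * Real.pi : ℝ) * Complex.I) * s)).im <
        α * Real.pi := by
  have hpi := Real.pi_pos
  have hα0 := h.alpha_pos
  have hα2 := h.alpha_le_two
  have ha0 := h.arg_nonneg
  have ha1 := h.pi_le
  have ha2 := h.le_two_pi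
  have ha3 := Complex.arg_le_pi s
  set β : ℝ := α * Real.pi with hβ
  set σ : ℂ := β * Complex.I + Complex.log s with hσ
  have hσim : σ.im = β + s.arg := by simp [hσ, Complex.log_im]
  have hσexp : Complex.exp ((β : ℝ) * Complex.I) * s = Complex.exp σ := by
    rw [hσ, Complex.exp_add, Complex.exp_log h.1]
  rw [hσexp]
  set X : ℂ := Complex.exp ζ - Complex.exp σ with hX
  -- `rot Y t` is `Y` rotated by the angle `-t`.
  set rot : ℂ → ℝ → ℂ := fun Y t => Y * Complex.exp (-(t * Complex.I)) with hrot
  have rim : ∀ (ζ : ℂ) (t : ℝ), (rot (Complex.exp ζ) t).im =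
    Real.exp ζ.re * Real.sin (ζ.im - t) := exp_im_mul
  have rre : ∀ (ζ : ℂ) (t : ℝ), (rot (Complex.exp ζ) t).re =
    Real.exp ζ.re * Real.cos (ζ.im - t) := exp_re_mul
  have rsub : ∀ t : ℝ, rot X t = rot (Complex.exp ζ) t - rot (Complex.exp σ) t := fun t => by
    simp only [hrot, hX]; ring
  by_cases hα1 : α ≤ 1
  · have hβπ : β ≤ Real.pi := by nlinarith
    have p1 : 0 < (rot X 0).im := by
      rw [rsub, Complex.sub_im, rim, rim, hσim, sub_zero, sub_zero]
      have k1 : 0 < Real.exp ζ.re * Real.sin ζ.im :=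
        mul_pos (Real.exp_pos _) (Real.sin_pos_of_pos_of_lt_pi h0 (by linarith))
      have k2 : 0 ≤ Real.sin (β + s.arg - Real.pi) :=
        Real.sin_nonneg_of_nonneg_of_le_pi (by linarith) (by linarith)
      rw [Real.sin_sub_pi] at k2
      nlinarith [Real.exp_pos σ.re]
    have p2 : (rot X β).im < 0 := by
      rw [rsub, Complex.sub_im, rim, rim, hσim]
      have k1 : Real.sin (ζ.im - β) < 0 :=
        Real.sin_neg_of_neg_of_neg_pi_lt (by linarith) (by linarith)
      have k2 : 0 ≤ Real.sin (β + s.arg - β) :=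
        Real.sin_nonneg_of_nonneg_of_le_pi (by linarith) (by linarith)
      have := mul_pos_of_neg_of_neg k1 (neg_neg_of_pos (Real.exp_pos ζ.re))
      nlinarith [Real.exp_pos σ.re]
    have hX0 : X ≠ 0 := fun h0 => by
      rw [h0] at p1
      simp [hrot] at p1
    refine ⟨hX0, ?_⟩
    rw [← exp_logOne hX0, rim, sub_zero] at p1
    rw [← exp_logOne hX0, rim] at p2
    have q1 := pos_of_mul_pos_right p1 (Real.exp_pos _).le
    have q2 : Real.sin ((logOne X).im - β) < 0 := by
      by_contra hc
      have := mul_nonneg (Real.exp_pos (logOne X).re).le (not_lt.1 hc)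
      linarith
    have q3 : (logOne X).im < Real.pi := by
      by_contra hc
      have k2 : 0 ≤ Real.sin ((logOne X).im - Real.pi) :=
        Real.sin_nonneg_of_nonneg_of_le_pi (by linarith) (by linarith [im_logOne_le X])
      rw [Real.sin_sub_pi] at k2
      linarith
    by_contra hc
    have k2 : 0 ≤ Real.sin ((logOne X).im - β) :=
      Real.sin_nonneg_of_nonneg_of_le_pi (by linarith) (by nlinarith)
    linarith
  · have hβπ : Real.pi < β := by nlinarith
    have hβ2 : β ≤ 2 * Real.pi := by nlinarith
    -- The closed convex sector of the arguments in `[β, 2π]`.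
    set γ : ℝ := β / 2 + Real.pi with hγ
    have key : ∀ ξ : ℂ, β ≤ ξ.im → ξ.im ≤ 2 * Real.pi →
        (rot (Complex.exp ξ) 0).im ≤ 0 ∧ 0 ≤ (rot (Complex.exp ξ) β).im ∧
          0 ≤ (rot (Complex.exp ξ) γ).re := by
      intro ξ g1 g2
      rw [rim, rim, rre, sub_zero]
      refine ⟨?_, ?_, ?_⟩
      · have k2 : 0 ≤ Real.sin (ξ.im - Real.pi) :=
          Real.sin_nonneg_of_nonneg_of_le_pi (by linarith) (by linarith)
        rw [Real.sin_sub_pi] at k2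
        nlinarith [Real.exp_pos ξ.re]
      · exact mul_nonneg (Real.exp_pos _).le
          (Real.sin_nonneg_of_nonneg_of_le_pi (by linarith) (by linarith))
      · exact mul_nonneg (Real.exp_pos _).le
          (Real.cos_nonneg_of_neg_pi_div_two_le_of_le (by linarith) (by linarith))
    have hσ3 := key σ (by rw [hσim]; linarith) (by rw [hσim]; linarith)
    by_contra hcon
    have hX3 : (rot X 0).im ≤ 0 ∧ 0 ≤ (rot X β).im ∧ 0 ≤ (rot X γ).re := by
      by_cases hX0 : X = 0
      · simp [hX0, hrot]
      · have h2 : β ≤ (logOne X).im := by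
          by_contra hc
          exact hcon ⟨hX0, not_le.1 hc⟩
        have := key (logOne X) h2 (im_logOne_le X)
        rwa [exp_logOne hX0] at this
    rw [rsub, rsub, rsub, Complex.sub_im, Complex.sub_im, Complex.sub_re] at hX3
    have z1 : (rot (Complex.exp ζ) 0).im ≤ 0 := by linarith [hX3.1, hσ3.1]
    have z2 : 0 ≤ (rot (Complex.exp ζ) β).im := by linarith [hX3.2.1, hσ3.2.1]
    have z3 : 0 ≤ (rot (Complex.exp ζ) γ).re := by linarith [hX3.2.2, hσ3.2.2]
    rw [rim, sub_zero] at z1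
    rw [rim] at z2
    rw [rre] at z3
    have w1 : Real.pi ≤ ζ.im := by
      by_contra hc
      have := mul_pos (Real.exp_pos ζ.re) (Real.sin_pos_of_pos_of_lt_pi h0 (not_le.1 hc))
      linarith
    have w2 : ζ.im - β ≤ -Real.pi := by
      by_contra hc
      have k1 := Real.sin_neg_of_neg_of_neg_pi_lt (x := ζ.im - β) (by linarith) (by linarith)
      have := mul_pos_of_neg_of_neg k1 (neg_neg_of_pos (Real.exp_pos ζ.re))
      nlinarith
    -- Only `α = 2` and `arg = π` are left.
    have w3 : ζ.im - γ = -Real.pi := by linarith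
    rw [w3, Real.cos_neg, Real.cos_pi] at z3
    linarith [Real.exp_pos ζ.re]

/-! ### Monotone stable laws -/

/-- The base `z ^ α + (-1) ^ (α - 1) s` of the power `1 / α` that defines the reciprocal Cauchy
transform of the monotone stable law. -/
noncomputable def stableBase (α : ℝ) (s z : ℂ) : ℂ := powOne z α + powOne (-1) (α - 1) * s

lemma powOne_neg_one_sub_one (α : ℝ) :
    powOne (-1) (α - 1) = -Complex.exp ((α * Real.pi : ℝ) * Complex.I) := by
  have h : ((α - 1 : ℝ) : ℂ) * (Real.pi * Complex.I) =
      ((α * Real.pi : ℝ) : ℂ) * Complex.I - Real.pi * Complex.I := by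
    push_cast; ring
  rw [powOne_neg_one, h, Complex.exp_sub, Complex.exp_pi_mul_I, div_neg, div_one]

lemma stableBase_eq {α : ℝ} {s z : ℂ} (hz : 0 < z.im) : stableBase α s z =
    Complex.exp (α * Complex.log z) - Complex.exp ((α * Real.pi : ℝ) * Complex.I) * s := by
  rw [stableBase, powOne_of_im_pos hz, powOne_neg_one_sub_one]
  ring

namespace Admissible

variable {α : ℝ} {s : ℂ}

lemma stableBase_mem (h : Admissible α s) {z : ℂ} (hz : 0 < z.im) :
    stableBase α s z ≠ 0 ∧ (logOne (stableBase α s z)).im < α * Real.pi := by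
  rw [stableBase_eq hz]
  have hα := h.alpha_pos
  have h1 := mul_pos hα (im_log_pos hz)
  have h2 := mul_lt_mul_of_pos_left (im_log_lt_pi hz) hα
  exact im_logOne_exp_sub_lt h (by rwa [Complex.im_ofReal_mul]) (by rwa [Complex.im_ofReal_mul])

lemma im_logOne_stableBase_lt (h : Admissible α s) {z : ℂ} (hz : 0 < z.im) :
    (logOne (stableBase α s z)).im < 2 * Real.pi :=
  (h.stableBase_mem hz).2.trans_le (mul_le_mul_of_nonneg_right h.alpha_le_two Real.pi_pos.le)

lemma im_powOne_stableBase_pos (h : Admissible α s) {z : ℂ} (hz : 0 < z.im) :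
    0 < (powOne (stableBase α s z) (1 / α)).im := by
  have hα := h.alpha_pos
  rw [powOne, Complex.exp_im, Complex.im_ofReal_mul, one_div, inv_mul_eq_div]
  refine mul_pos (Real.exp_pos _) (Real.sin_pos_of_pos_of_lt_pi ?_ ?_)
  · exact div_pos (im_logOne_pos _) hα
  · rw [div_lt_iff₀ hα, mul_comm]
    exact (h.stableBase_mem hz).2

lemma differentiableOn_powOne_stableBase (h : Admissible α s) :
    DifferentiableOn ℂ (fun z => powOne (stableBase α s z) (1 / α)) {z | 0 < z.im} := by
  have hX : DifferentiableOn ℂ (stableBase α s) {z | 0 < z.im} := by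
    have h1 : DifferentiableOn ℂ (fun z => Complex.exp (α * Complex.log z) -
        Complex.exp ((α * Real.pi : ℝ) * Complex.I) * s) {z | 0 < z.im} := by
      intro z hz
      have hz : 0 < z.im := hz
      have h2 : DifferentiableAt ℂ Complex.log z :=
        Complex.differentiableAt_log (Or.inr hz.ne')
      exact (((h2.const_mul _).cexp).sub_const _).differentiableWithinAt
    exact h1.congr fun z hz => stableBase_eq hz
  intro z hz
  have hXz : DifferentiableAt ℂ (stableBase α s) z :=
    hX.differentiableAt (isOpen_upperHalfPlane.mem_nhds hz)
  have h3 := (differentiableAt_logOne (h.stableBase_mem hz).1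
    (h.im_logOne_stableBase_lt hz)).comp z hXz
  exact ((h3.const_mul _).cexp).differentiableWithinAt

/-- `F(iy) / (iy) → 1` for the reciprocal Cauchy transform of the monotone stable law. -/
lemma tendsto_mul_inv_powOne_stableBase (h : Admissible α s) :
    Tendsto (fun y : ℝ => (y * Complex.I) *
      (powOne (stableBase α s (y * Complex.I)) (1 / α))⁻¹) atTop (𝓝 1) := by
  have hα := h.alpha_pos
  have hα2 := h.alpha_le_two
  have hpi := Real.pi_pos
  set ω : ℂ := (α * (Real.pi / 2) : ℝ) * Complex.I with hω
  have hωim : ω.im = α * (Real.pi / 2) := by simp [hω]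
  have hω0 : 0 < ω.im := by rw [hωim]; positivity
  have hω1 : ω.im < 2 * Real.pi := by rw [hωim]; nlinarith
  set p : ℂ := Complex.exp ((α * Real.pi : ℝ) * Complex.I) * s with hp
  -- `F(iy) / (iy) = exp ((logOne (e^ω - p y^{-α}) - ω) / α)`
  have hlog : ∀ y : ℝ, 0 < y → Complex.log (y * Complex.I) =
      Real.log y + (Real.pi / 2 : ℝ) * Complex.I := fun y hy => by
    rw [Complex.log_ofReal_mul hy Complex.I_ne_zero, Complex.log_I]
    push_cast; ring
  have hlim : Tendsto (fun y : ℝ => Complex.exp ω - p * ((y ^ (-α) : ℝ) : ℂ)) atTop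
      (𝓝 (Complex.exp ω)) := by
    have h1 := (Complex.continuous_ofReal.tendsto 0).comp (tendsto_rpow_neg_atTop hα)
    have h2 := (h1.const_mul p).const_sub (Complex.exp ω)
    simpa using h2
  have hcont : ContinuousAt logOne (Complex.exp ω) :=
    (differentiableAt_logOne (Complex.exp_ne_zero _) (by rwa [logOne_exp hω0 hω1])).continuousAt
  have hlim2 := hcont.tendsto.comp hlim
  rw [logOne_exp hω0 hω1] at hlim2
  have hlim3 : Tendsto (fun y : ℝ => Complex.exp ((1 / α : ℝ) *
      (ω - logOne (Complex.exp ω - p * ((y ^ (-α) : ℝ) : ℂ))))) atTop (𝓝 1) := by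
    have h1 := (hlim2.const_sub ω).const_mul ((1 / α : ℝ) : ℂ)
    rw [sub_self, mul_zero] at h1
    have h2 := (Complex.continuous_exp.tendsto 0).comp h1
    rw [Complex.exp_zero] at h2
    exact h2
  refine hlim3.congr' ?_
  filter_upwards [eventually_gt_atTop 0] with y hy
  have him : 0 < (y * Complex.I : ℂ).im := by simpa using hy
  have hyα : 0 < y ^ α := Real.rpow_pos_of_pos hy α
  have hX : stableBase α s (y * Complex.I) =
      ((y ^ α : ℝ) : ℂ) * (Complex.exp ω - p * ((y ^ (-α) : ℝ) : ℂ)) := by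
    have h1 : ((y ^ α : ℝ) : ℂ) = Complex.exp (α * Real.log y) := by
      rw [Real.rpow_def_of_pos hy, Complex.ofReal_exp]
      push_cast; ring_nf
    have h2 : ((y ^ α : ℝ) : ℂ) * ((y ^ (-α) : ℝ) : ℂ) = 1 := by
      rw [← Complex.ofReal_mul, Real.rpow_neg hy.le, mul_inv_cancel₀ hyα.ne', Complex.ofReal_one]
    rw [stableBase_eq him, hlog y hy, mul_sub, mul_left_comm, h2, mul_one, h1, ← Complex.exp_add]
    congr 2
    rw [hω]
    push_cast; ring
  have hne : Complex.exp ω - p * ((y ^ (-α) : ℝ) : ℂ) ≠ 0 := fun h0 => by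
    have := (h.stableBase_mem him).1
    rw [hX, h0, mul_zero] at this
    exact this rfl
  have hy2 : (y * Complex.I : ℂ) = Complex.exp (Complex.log (y * Complex.I)) :=
    (Complex.exp_log (ne_zero_of_im_pos him)).symm
  have hα' : (α : ℂ) ≠ 0 := Complex.ofReal_ne_zero.2 hα.ne'
  rw [powOne, ← Complex.exp_neg]
  nth_rewrite 1 [hy2]
  rw [← Complex.exp_add, hX, logOne_ofReal_mul hyα hne, hlog y hy, Real.log_rpow hy]
  congr 1
  rw [hω]
  push_cast
  field_simp
  ring

theorem exists_isMonotoneStable (h : Admissible α s) : ∃ a, IsMonotoneStable α s a := by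
  obtain ⟨a, ha, hG⟩ := exists_cauchyTransform_eq
    (G := fun z => (powOne (stableBase α s z) (1 / α))⁻¹)
    (h.differentiableOn_powOne_stableBase.inv fun z hz =>
      ne_zero_of_im_pos (h.im_powOne_stableBase_pos hz)) (fun z hz => by
      rw [Complex.inv_im]
      exact div_nonpos_of_nonpos_of_nonneg (neg_nonpos.2 (h.im_powOne_stableBase_pos hz).le)
        (Complex.normSq_nonneg _))
    h.tendsto_mul_inv_powOne_stableBase
  exact ⟨a, ha, fun z hz => by rw [recipCauchy, hG z hz, inv_inv, stableBase]⟩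

/-- The monotone stable law has no atom at the origin, because its reciprocal Cauchy transform has
the nonzero limit modulus `|s| ^ (1 / α)` there. -/
lemma measure_singleton_zero (h : Admissible α s) {a : Measure ℝ} (ha : IsMonotoneStable α s a) :
    a {0} = 0 := by
  have hα := h.alpha_pos
  have hprob := ha.1
  set p : ℂ := Complex.exp ((α * Real.pi : ℝ) * Complex.I) * s with hp
  have hpn : ‖-p‖ ≠ 0 := by
    rw [norm_neg, hp, norm_mul, Complex.norm_exp_ofReal_mul_I, one_mul]
    exact norm_ne_zero_iff.2 h.1
  have hXlim : Tendsto (fun y : ℝ => stableBase α s (y * Complex.I)) (𝓝[>] 0) (𝓝 (-p)) := by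
    have h1 : Tendsto (fun y : ℝ => Complex.exp (α * Complex.log (y * Complex.I))) (𝓝[>] 0)
        (𝓝 0) := by
      have h2 : Tendsto (fun y : ℝ => y ^ α) (𝓝[>] 0) (𝓝 0) := by
        have := (Real.continuousAt_rpow_const 0 α (Or.inr hα.le)).tendsto
        rw [Real.zero_rpow hα.ne'] at this
        exact this.mono_left nhdsWithin_le_nhds
      refine squeeze_zero_norm' ?_ h2
      filter_upwards [self_mem_nhdsWithin] with y hy
      have hy : 0 < y := hy
      rw [Complex.norm_exp, Complex.re_ofReal_mul, Complex.log_re, norm_mul, Complex.norm_I,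
        mul_one, Complex.norm_real, Real.norm_eq_abs, abs_of_pos hy, Real.rpow_def_of_pos hy,
        mul_comm]
    have h3 := h1.sub_const p
    rw [zero_sub] at h3
    refine h3.congr' ?_
    filter_upwards [self_mem_nhdsWithin] with y hy
    rw [stableBase_eq (by simpa using hy)]
  have hFlim : Tendsto (fun y : ℝ => ‖powOne (stableBase α s (y * Complex.I)) (1 / α)‖) (𝓝[>] 0)
      (𝓝 (Real.exp (1 / α * Real.log ‖-p‖))) := by
    have h1 := (Real.continuous_exp.tendsto _).comp
      (((Real.continuousAt_log hpn).tendsto.comp hXlim.norm).const_mul (1 / α))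
    refine h1.congr fun y => ?_
    simp [powOne, Complex.norm_exp, logOne, Complex.log_re]
  have hlim : Tendsto (fun y : ℝ => y * ‖powOne (stableBase α s (y * Complex.I)) (1 / α)‖⁻¹)
      (𝓝[>] 0) (𝓝 0) := by
    have h1 : Tendsto (fun y : ℝ => y) (𝓝[>] 0) (𝓝 0) := nhdsWithin_le_nhds
    have h2 := h1.mul (hFlim.inv₀ (Real.exp_ne_zero _))
    rwa [zero_mul] at h2
  have hle : a.real {0} ≤ 0 := by
    refine ge_of_tendsto hlim ?_
    filter_upwards [self_mem_nhdsWithin] with y hy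
    have hy : 0 < y := hy
    have h1 := measureReal_singleton_zero_le a hy
    have h2 := ha.2 (y * Complex.I) (by simpa using hy)
    rw [recipCauchy] at h2
    rw [← inv_inv (cauchyTransform a (y * Complex.I)), h2, norm_inv] at h1
    exact h1
  have h0 : a.real {0} = 0 := le_antisymm hle measureReal_nonneg
  rwa [measureReal_eq_zero_iff] at h0

end Admissible

/-! ### The Cauchy transform of the free compound Poisson law -/

lemma HasFreePoissonInverse.im_le_im_recipCauchy {lam : ℝ} (hlam : 0 ≤ lam) {a μ : Measure ℝ}
    [IsProbabilityMeasure a] (h : HasFreePoissonInverse lam a μ) {w : ℂ} (hw : 0 < w.im) :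
    w.im ≤ (recipCauchy μ w).im := by
  have h1 := im_freePoissonInverse lam a (h.im_pos w hw)
  rw [h.inverse_eq w hw] at h1
  have := mul_nonneg hlam (quadMean_nonneg a (recipCauchy μ w))
  nlinarith [h.im_pos w hw]

lemma HasFreePoissonInverse.continuousOn_recipCauchy {lam : ℝ} {a μ : Measure ℝ}
    (h : HasFreePoissonInverse lam a μ) : ContinuousOn (recipCauchy μ) {w | 0 < w.im} := by
  have := h.prob
  refine (differentiableOn_cauchyTransform μ).continuousOn.inv₀ fun w hw h0 => ?_
  have h1 := h.im_pos w hw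
  rw [recipCauchy, h0] at h1
  simp at h1

namespace Admissible

variable {α : ℝ} {s : ℂ}

/-- `s (-1/w) ^ α` avoids the half-line `[0, ∞)`, since admissibility keeps its argument in
`(0, 2π)`. -/
lemma mul_powOne_ne_ofReal (h : Admissible α s) {w : ℂ} (hw : 0 < w.im) {t : ℝ} (ht : 0 ≤ t) :
    s * powOne (-1 / w) α ≠ t := by
  intro heq
  have hα := h.alpha_pos
  have hpi := Real.pi_pos
  set ξ : ℂ := Complex.log s + α * (Real.pi * Complex.I - Complex.log w) with hξ
  have him : ξ.im = s.arg + α * (Real.pi - (Complex.log w).im) := by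
    rw [hξ, Complex.add_im, Complex.im_ofReal_mul, Complex.log_im]
    simp
  have hθ0 := im_log_pos hw
  have hθ1 := im_log_lt_pi hw
  have h1 : 0 < ξ.im := by
    rw [him]
    have := mul_pos hα (sub_pos.2 hθ1)
    linarith [h.arg_nonneg]
  have h2 : ξ.im < 2 * Real.pi := by
    rw [him]
    have := mul_pos hα hθ0
    linarith [h.le_two_pi]
  have h3 : Complex.exp ξ = t := by
    rw [hξ, Complex.exp_add, Complex.exp_log h.1, ← powOne_neg_one_div hw, heq]
  have h4 := congrArg Complex.im h3
  have h5 := congrArg Complex.re h3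
  rw [Complex.exp_im, Complex.ofReal_im, mul_eq_zero, or_iff_right (Real.exp_ne_zero _)] at h4
  rw [Complex.exp_re, Complex.ofReal_re] at h5
  have h6 : 0 ≤ Real.cos ξ.im := by
    by_contra hc
    have := mul_pos_of_neg_of_neg (not_le.1 hc) (neg_neg_of_pos (Real.exp_pos ξ.re))
    linarith
  have h7 : Real.cos ξ.im = 1 := by
    have := Real.sin_sq_add_cos_sq ξ.im
    rw [h4] at this
    nlinarith
  rw [Real.cos_eq_one_iff_of_lt_of_lt (by linarith) h2] at h7
  linarith

/-- With `u = (-1/z) ^ α`, the equation `z² / F_a(z) = w` reads `(-1/w) ^ α = u - u² s / 4`. -/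
lemma powOne_neg_one_div_eq (h : Admissible α s) {z w : ℂ} (hz : 0 < z.im) (hw : 0 < w.im)
    (hzw : z ^ 2 * (powOne (stableBase α (s / 4) z) (1 / α))⁻¹ = w) :
    powOne (-1 / w) α = powOne (-1 / z) α - powOne (-1 / z) α ^ 2 * (s / 4) := by
  have h4 := h.div_four
  have hα := h.alpha_pos
  have hα' : (α : ℂ) ≠ 0 := Complex.ofReal_ne_zero.2 hα.ne'
  have hX := h4.stableBase_mem hz
  set L : ℂ := logOne (stableBase α (s / 4) z) with hL
  have hexpL : Complex.exp L = stableBase α (s / 4) z := exp_logOne hX.1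
  set ℓ : ℂ := Complex.log z with hℓ
  set κ : ℂ := 2 * ℓ - (1 / α : ℝ) * L with hκ
  have hwexp : w = Complex.exp κ := by
    rw [← hzw, powOne, ← hL, ← Complex.exp_neg, hκ, sub_eq_add_neg, Complex.exp_add, two_mul,
      Complex.exp_add, hℓ, Complex.exp_log (ne_zero_of_im_pos hz), sq]
  have hκim : κ.im = 2 * ℓ.im - L.im / α := by
    rw [hκ, Complex.sub_im, Complex.im_ofReal_mul]
    simp
    ring
  have hθ0 := im_log_pos hz
  have hθ1 := im_log_lt_pi hz
  have hL0 : 0 < L.im / α := div_pos (im_logOne_pos _) hα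
  have hL1 : L.im / α < Real.pi := by
    rw [div_lt_iff₀ hα, mul_comm]
    exact hX.2
  have hsin : 0 < Real.sin κ.im := by
    rw [hwexp, Complex.exp_im] at hw
    exact pos_of_mul_pos_right hw (Real.exp_pos _).le
  -- `arg w` is determined modulo `2π`; as `w` is in the upper half-plane it lies in `(0, π)`.
  have hκ0 : 0 < κ.im := by
    by_contra hc
    have : Real.sin κ.im ≤ 0 :=
      Real.sin_nonpos_of_nonpos_of_neg_pi_le (not_lt.1 hc) (by rw [hκim]; linarith)
    linarith
  have hκ1 : κ.im < Real.pi := by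
    by_contra hc
    have k : 0 ≤ Real.sin (κ.im - Real.pi) :=
      Real.sin_nonneg_of_nonneg_of_le_pi (by linarith) (by rw [hκim]; linarith)
    rw [Real.sin_sub_pi] at k
    linarith
  have hlogw : Complex.log w = κ := by
    rw [hwexp, Complex.log_exp (by linarith [Real.pi_pos]) hκ1.le]
  rw [powOne_neg_one_div hw, hlogw, powOne_neg_one_div hz]
  have e1 : (α : ℂ) * (Real.pi * Complex.I - κ) =
      α * (Real.pi * Complex.I - ℓ) + (L - α * ℓ) := by
    rw [hκ]
    push_cast
    field_simp
    ring
  have e2 : Complex.exp (α * (Real.pi * Complex.I - ℓ)) =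
      Complex.exp ((α * Real.pi : ℝ) * Complex.I) * Complex.exp (-(α * ℓ)) := by
    rw [← Complex.exp_add]
    congr 1
    push_cast; ring
  have e3 : Complex.exp (α * ℓ) * Complex.exp (-(α * ℓ)) = 1 := by
    rw [← Complex.exp_add, add_neg_cancel, Complex.exp_zero]
  rw [e1, Complex.exp_add, sub_eq_add_neg L, Complex.exp_add, hexpL, stableBase_eq hz, ← hℓ, e2]
  linear_combination (Complex.exp ((α * Real.pi : ℝ) * Complex.I) * Complex.exp (-(α * ℓ))) * e3

/-- The free compound Poisson law with rate `1` and jump distribution `a^α_{s/4}` has the Cauchy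
transform of `μ^α_{s,2}`. The square root `1 - s u / 2` of `1 - s (-1/w) ^ α` is the principal one:
its real part has no zero in the upper half-plane and is positive far out. -/
theorem isMuLaw (h : Admissible α s) {a μ : Measure ℝ} (ha : IsMonotoneStable α (s / 4) a)
    (hμ : HasFreePoissonInverse 1 a μ) : IsMuLaw α s 2 μ := by
  have hα := h.alpha_pos
  have hα2 := h.alpha_le_two
  have hα' : (α : ℂ) ≠ 0 := Complex.ofReal_ne_zero.2 hα.ne'
  have hprob := ha.1
  set u : ℂ → ℂ := fun w => powOne (-1 / recipCauchy μ w) α with hu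
  have hquad : ∀ w : ℂ, 0 < w.im → powOne (-1 / w) α = u w - u w ^ 2 * (s / 4) := by
    intro w hw
    refine h.powOne_neg_one_div_eq (hμ.im_pos w hw) hw ?_
    have h1 := hμ.inverse_eq w hw
    have h2 := ha.2 _ (hμ.im_pos w hw)
    have h3 : (powOne (stableBase α (s / 4) (recipCauchy μ w)) (1 / α))⁻¹ =
        cauchyTransform a (recipCauchy μ w) := by
      rw [stableBase, ← h2, recipCauchy.eq_1 a, inv_inv]
    rw [freePoissonInverse] at h1
    push_cast at h1
    rw [h3]
    linear_combination h1
  have hsquare : ∀ w : ℂ, 0 < w.im →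
      1 - s * powOne (-1 / w) α = (1 - s * u w / 2) ^ 2 := fun w hw => by
    rw [hquad w hw]; ring
  have hne : ∀ w : ℂ, 0 < w.im → (1 - s * u w / 2).re ≠ 0 := by
    intro w hw h0
    have h1 : (1 - s * u w / 2) ^ 2 = ((-(1 - s * u w / 2).im ^ 2 : ℝ) : ℂ) := by
      apply Complex.ext <;> simp [sq, h0, -Complex.sub_re, -Complex.sub_im]
    have h2 : s * powOne (-1 / w) α = ((1 + (1 - s * u w / 2).im ^ 2 : ℝ) : ℂ) := by
      have h3 := hsquare w hw
      rw [h1] at h3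
      push_cast at h3 ⊢
      linear_combination -h3
    exact h.mul_powOne_ne_ofReal hw (by positivity) h2
  have hcont : ContinuousOn (fun w => (1 - s * u w / 2).re) {w | 0 < w.im} := by
    have h1 : ContinuousOn (fun w => Complex.exp (α * (Real.pi * Complex.I -
        Complex.log (recipCauchy μ w)))) {w | 0 < w.im} :=
      (continuousOn_const.mul (continuousOn_const.sub (hμ.continuousOn_recipCauchy.clog
        fun w hw => Or.inr (hμ.im_pos w hw).ne'))).cexp
    have h2 : ContinuousOn u {w | 0 < w.im} :=
      h1.congr fun w hw => powOne_neg_one_div (hμ.im_pos w hw) α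
    exact Complex.continuous_re.comp_continuousOn
      (continuousOn_const.sub ((continuousOn_const.mul h2).div_const 2))
  have hpos : ∀ w : ℂ, 0 < w.im → 0 < (1 - s * u w / 2).re := by
    -- At `w = iy` with `y ^ α = |s|` one has `|s u / 2| ≤ 1 / 2`.
    set y : ℝ := Real.exp (Real.log ‖s‖ / α) with hy
    have hy0 : 0 < y := Real.exp_pos _
    have hyim : (y * Complex.I : ℂ).im = y := by simp
    have hw₀ : 0 < (y * Complex.I : ℂ).im := by rwa [hyim]
    have hfar : 0 < (1 - s * u (y * Complex.I) / 2).re := by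
      have hs : 0 < ‖s‖ := norm_pos_iff.2 h.1
      have hz := hμ.im_pos _ hw₀
      have h1 : y ≤ ‖recipCauchy μ (y * Complex.I)‖ := by
        have h2 := hμ.im_le_im_recipCauchy zero_le_one hw₀
        rw [hyim] at h2
        exact h2.trans ((le_abs_self _).trans (Complex.abs_im_le_norm _))
      have h2 : ‖u (y * Complex.I)‖ ≤ ‖s‖⁻¹ := by
        simp only [hu]
        rw [powOne_neg_one_div hz, Complex.norm_exp, Complex.re_ofReal_mul, ← Real.exp_log hs,
          ← Real.exp_neg]
        refine Real.exp_le_exp.2 ?_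
        have h3 := Real.log_le_log hy0 h1
        rw [hy, Real.log_exp, div_le_iff₀ hα] at h3
        rw [Complex.sub_re, Complex.log_re]
        simp
        linarith
      have h3 : ‖s * u (y * Complex.I) / 2‖ ≤ 1 / 2 := by
        rw [norm_div, norm_mul, Complex.norm_ofNat]
        have := mul_le_mul_of_nonneg_left h2 hs.le
        rw [mul_inv_cancel₀ hs.ne'] at this
        linarith
      have h4 := (abs_le.1 ((Complex.abs_re_le_norm _).trans h3)).2
      rw [Complex.sub_re, Complex.one_re]
      linarith
    intro w hw
    by_contra hc
    obtain ⟨w', hw', h0⟩ := isPreconnected_upperHalfPlane.intermediate_value hw hw₀ hcont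
      ⟨not_lt.1 hc, hfar.le⟩
    exact hne w' hw' h0
  refine ⟨hμ.prob, fun w hw => ?_⟩
  set z : ℂ := recipCauchy μ w with hz
  have hzim : 0 < z.im := hμ.im_pos w hw
  have hroot : (1 - s * powOne (-1 / w) α) ^ ((1 / (2 : ℝ) : ℝ) : ℂ) = 1 - s * u w / 2 := by
    rw [hsquare w hw]
    have : ((1 / (2 : ℝ) : ℝ) : ℂ) = 2⁻¹ := by push_cast; norm_num
    rw [this, Complex.sq_cpow_two_inv (hpos w hw)]
  have hbase : (1 - (1 - s * u w / 2)) / s =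
      Complex.exp (α * (Real.pi * Complex.I - Complex.log z) - Real.log 2) := by
    rw [Complex.exp_sub, ← powOne_neg_one_div hzim, ← Complex.ofReal_exp,
      Real.exp_log two_pos]
    have := h.1
    simp only [hu, ← hz]
    push_cast
    field_simp
    ring
  have hθ0 := im_log_pos hzim
  have hθ1 := im_log_lt_pi hzim
  have him : (α * (Real.pi * Complex.I - Complex.log z) - (Real.log 2 : ℝ) : ℂ).im =
      α * (Real.pi - (Complex.log z).im) := by
    rw [Complex.sub_im, Complex.im_ofReal_mul, Complex.ofReal_im, sub_zero]
    simp
  have hrpow : (((2 : ℝ) ^ (1 / α) : ℝ) : ℂ) = Complex.exp ((1 / α : ℝ) * Real.log 2) := by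
    rw [Real.rpow_def_of_pos two_pos, Complex.ofReal_exp]
    push_cast; ring_nf
  rw [muCauchy, hroot, hbase, powOne_exp (by rw [him]; exact mul_pos hα (by linarith))
    (by rw [him]; nlinarith [Real.pi_pos]), hrpow, neg_mul, ← Complex.exp_add]
  have hexp : ((1 / α : ℝ) : ℂ) * Real.log 2 + ((1 / α : ℝ) : ℂ) *
      (α * (Real.pi * Complex.I - Complex.log z) - Real.log 2) =
      Real.pi * Complex.I - Complex.log z := by
    push_cast
    field_simp
    ring
  rw [hexp, Complex.exp_sub, Complex.exp_pi_mul_I, Complex.exp_log (ne_zero_of_im_pos hzim), hz,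
    recipCauchy]
  simp

end Admissible

lemma IsMuLaw.hasFreePoissonInverse {α r : ℝ} {s : ℂ} {lam : ℝ} {a μ ν : Measure ℝ}
    (hμ : IsMuLaw α s r μ) (hν : IsMuLaw α s r ν) (h : HasFreePoissonInverse lam a μ) :
    HasFreePoissonInverse lam a ν := by
  have heq : ∀ w : ℂ, 0 < w.im → recipCauchy ν w = recipCauchy μ w := fun w hw => by
    rw [recipCauchy, recipCauchy, hν.2 w hw, hμ.2 w hw]
  exact ⟨hν.1, fun w hw => heq w hw ▸ h.im_pos w hw, fun w hw => heq w hw ▸ h.inverse_eq w hw⟩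

end FreeProb

theorem mainTheorem3 (α : ℝ) (s : ℂ) (h : FreeProb.Admissible α s) :
    -- both measures exist
    FreeProb.IsMuLaw α s 2 (FreeProb.muLaw α s 2) ∧
    FreeProb.IsMonotoneStable α (s / 4) (FreeProb.monotoneStable α (s / 4)) ∧
    -- the Voiculescu transform of `μ^α_{s,2}` is defined far out in every cone
    (∀ η : ℝ, 0 < η → ∃ M : ℝ, 0 < M ∧
      FreeProb.truncCone η M ⊆ FreeProb.voiculescuDomain (FreeProb.muLaw α s 2)) ∧
    -- `μ^α_{s,2}` is free compound Poisson, with rate `1` and jump distribution `a^α_{s/4}`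
    FreeProb.IsFreeCompoundPoisson (FreeProb.muLaw α s 2) ∧
    FreeProb.IsFreeCompoundPoissonWith (FreeProb.muLaw α s 2) 1
      (FreeProb.monotoneStable α (s / 4)) ∧
    -- its Lévy measure is `a^α_{s/4}`
    FreeProb.IsFreeLevyMeasure (FreeProb.muLaw α s 2) (FreeProb.monotoneStable α (s / 4)) ∧
    (∀ z : ℂ, z⁻¹ ∈ FreeProb.voiculescuDomain (FreeProb.muLaw α s 2) →
      FreeProb.rTransform (FreeProb.muLaw α s 2) z =
        FreeProb.psiTransform (FreeProb.monotoneStable α (s / 4)) z) ∧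
    (∀ z ∈ FreeProb.voiculescuDomain (FreeProb.muLaw α s 2),
      FreeProb.voiculescu (FreeProb.muLaw α s 2) z =
        z ^ 2 * FreeProb.cauchyTransform (FreeProb.monotoneStable α (s / 4)) z - z) ∧
    -- it is freely infinitely divisible
    FreeProb.IsFreelyInfDiv (FreeProb.muLaw α s 2) := by
  have hex : ∃ a, FreeProb.IsMonotoneStable α (s / 4) a := h.div_four.exists_isMonotoneStable
  have ha : FreeProb.IsMonotoneStable α (s / 4) (FreeProb.monotoneStable α (s / 4)) := by
    rw [FreeProb.monotoneStable, dif_pos hex]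
    exact hex.choose_spec
  have hprob : MeasureTheory.IsProbabilityMeasure (FreeProb.monotoneStable α (s / 4)) := ha.1
  have hzero := h.div_four.measure_singleton_zero ha
  obtain ⟨μ, hμ⟩ := FreeProb.exists_hasFreePoissonInverse zero_le_one
    (FreeProb.monotoneStable α (s / 4))
  have hlaw := h.isMuLaw ha hμ
  have hmuEx : ∃ μ, FreeProb.IsMuLaw α s 2 μ := ⟨μ, hlaw⟩
  have hmu : FreeProb.IsMuLaw α s 2 (FreeProb.muLaw α s 2) := by
    rw [FreeProb.muLaw, dif_pos hmuEx]
    exact hmuEx.choose_spec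
  have hinv := hlaw.hasFreePoissonInverse hmu hμ
  have hcp : FreeProb.IsFreeCompoundPoissonWith (FreeProb.muLaw α s 2) 1
      (FreeProb.monotoneStable α (s / 4)) :=
    ⟨hmu.1, zero_le_one, hprob, hzero, fun z hz => by
      rw [hinv.rTransform_eq_psiTransform hz, Complex.ofReal_one, one_mul]⟩
  refine ⟨hmu, ha, fun η hη => ?_, ⟨_, _, hcp⟩, hcp, hinv.isFreeLevyMeasure hzero,
    fun z hz => hinv.rTransform_eq_psiTransform hz,
    fun z hz => hinv.voiculescu_eq_sq_mul_sub hz, hinv.isFreelyInfDiv zero_le_one⟩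
  obtain ⟨M, hM, hsub⟩ := hinv.exists_truncCone_subset zero_le_one hη
  exact ⟨M, hM, hsub M le_rfl⟩
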